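/- Let $n,r\ge 0$ be integers. Let $\mathbf S_0(n,r)$ be the $0$-Schur algebra over $\mathbb C$, with its standard basis $e_A$ indexed by the set $M_n(r)$ of $n\times n$ matrices $A=(a_{i,j})$ of nonnegative integers with total sum $r$. Write $\mathrm{ro}(A)$ and $\mathrm{co}(A)$ for the row-sum and column-sum vectors of $A$. The product is $e_Ae_B=0$ if $\mathrm{co}(A)\ne \mathrm{ro}(B)$, and otherwise $e_Ae_B=e_C$, where $C\in M_n(r)$ is the matrix whose corner sums $R_C(i,j)=\sum_{k\le i,\,l\le j}c_{k,l}$ are $$R_C(i,j)=\max_{0\le k\le n}\bigl(R_A(i,k)+R_B(k,j)-R_B(k,n)\bigr)$$ (equivalently, $C$ is the open orbit in the composite of the orbits $A$ and $B$ of pairs of $n$-step flags in $\mathbb C^r$). For a weak composition $\lambda=(\lambda_1,\dots,\lambda_n)$ of $r$ put $D_\lambda=\mathrm{diag}(\lambda_1,\dots,\lambda_n)$ and $k_\lambda=e_{D_\lambda}$; the unit is $\sum_\lambda k_\lambda$. For $1\le i\le n-1$ let $$e_i=\sum_{\lambda:\lambda_{i+1}>0}e_{D_\lambda-E_{i+1,i+1}+E_{i,i+1}},\qquad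 f_i=\sum_{\lambda:\lambda_i>0}e_{D_\lambda-E_{i,i}+E_{i+1,i}},$$ where the $E_{a,b}$ are the matrix units. Let $\lambda$ be a weak composition of $r$ of length $n$ such that $\lambda_i=0$ implies $\lambda_j=0$ for all $j>i$. A strong composition $\alpha$ of $n$ (one with positive parts) cuts $\{1,\dots,n\}$ into consecutive intervals; it is called maximal with respect to $\lambda$ if, for each of these intervals, the corresponding subsequence of $\lambda$ is either $(0)$ or has neither its first nor its last entry equal to $0$. A matrix $A\in M_n(r)$ is open on columns with respect to $\alpha$ if there are no $i<i'$ and $j<j'$, with $j,j'$ in the same interval of $\alpha$, such that $a_{i,j}>0$ and $a_{i',j'}>0$. Let $B^\lambda$ be the set of all $e_A$ with $\mathrm{co}(A)=\lambda$ such that $A$ is not open on columns with respect to any $\alpha\neq(1,\dots,1)$ that is maximal with respect to $\lambda$. Let $P_\lambda$ be the $\mathbf S_0(n,r)$-module with $\mathbb C$-basis $B^\lambda$ on which algebra elements act by multiplication in $\mathbf S_0(n,r)$ followed by deleting all basis elements outside $B^\lambda$. A matrix $A$ of nonnegative integers is column block diagonal if $a_{i,j}>0$ implies $a_{s,t}=0$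 for all $s\le i$ and $t>j$. Let $\mathrm{CB}(\lambda)$ be the set of column block diagonal $A\in M_n(r)$ with $\mathrm{co}(A)=\lambda$, and let $\beta^\lambda=\{e_A: A\in \mathrm{CB}(\lambda)\}\subseteq B^\lambda$. Let $N_\lambda\subseteq P_\lambda$ be the submodule spanned over $\mathbb C$ by $B^\lambda\setminus\beta^\lambda$, let $S_\lambda=P_\lambda/N_\lambda$, and write $\overline{e_A}$ and $\overline{k_\lambda}$ for the classes of $e_A$ and $k_\lambda$ in $S_\lambda$. Let $A\in \mathrm{CB}(\lambda)$. Then: (1) There are $l\ge 0$ and indices $1\le i_1,\dots,i_l\le n-1$ such that $e_{i_1}e_{i_2}\cdots e_{i_l}\cdot\overline{e_A}=\overline{k_\lambda}$. (2) For all $l\ge 0$ and all indices $1\le i_1,\dots,i_l\le n-1$, $$e_{i_1}e_{i_2}\cdots e_{i_l}\cdot\overline{e_A}=\overline{k_\lambda}\iff \overline{e_A}=f_{i_l}\cdots f_{i_2}f_{i_1}\cdot\overline{k_\lambda}.$$ (3) If $\overline{e_A}=f_{i_l}\cdots f_{i_2}f_{i_1}\cdot\overline{k_\lambda}=f_{j_s}\cdots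 f_{j_2}f_{j_1}\cdot\overline{k_\lambda}$, then the multisets $\{i_1,\dots,i_l\}$ and $\{j_1,\dots,j_s\}$ are equal. In particular, $l=s$. -/

import Mathlib

namespace ZeroSchur

open Finset

/-! ### Weak compositions, matrices, corner sums -/

/-- `Λ(n,r)`: weak compositions of `r` of length `n`. -/
def WComp (n r : ℕ) : Type := {l : Fin n → ℕ // ∑ i, l i = r}

instance (n r : ℕ) : DecidableEq (WComp n r) :=
  inferInstanceAs (DecidableEq {l : Fin n → ℕ // ∑ i, l i = r})

instance (n r : ℕ) : Fintype (WComp n r) :=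
  Fintype.subtype (Finset.piAntidiag Finset.univ r) (by simp)

/-- Membership in `Λ•(n,r)`: a zero part is followed by zero parts only. -/
def IsBullet {n r : ℕ} (l : WComp n r) : Prop :=
  ∀ i j : Fin n, i < j → l.1 i = 0 → l.1 j = 0

/-- `M_n(r)`: the `n × n` matrices of nonnegative integers with total sum `r`. -/
def Mat (n r : ℕ) : Type := {A : Matrix (Fin n) (Fin n) ℕ // ∑ i, ∑ j, A i j = r}

/-- The row-sum vector. -/
def ro {n : ℕ} (A : Matrix (Fin n) (Fin n) ℕ) : Fin n → ℕ := fun i => ∑ j, A i j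

/-- The column-sum vector. -/
def co {n : ℕ} (A : Matrix (Fin n) (Fin n) ℕ) : Fin n → ℕ := fun j => ∑ i, A i j

/-- The entries of `A`, extended by zero to all pairs of natural numbers. -/
def entry {n : ℕ} (A : Matrix (Fin n) (Fin n) ℕ) (k l : ℕ) : ℤ :=
  if h : k < n ∧ l < n then (A ⟨k, h.1⟩ ⟨l, h.2⟩ : ℤ) else 0

/-- The sum of the entries of `A` in the first `i` rows and first `j` columns. If `A` is the
relative position of a pair of flags `(V, V')`, this is `dim (V_i ∩ V'_j)`. -/
def corner {n : ℕ} (A : Matrix (Fin n) (Fin n) ℕ) (i j : ℕ) : ℤ :=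
  ∑ k ∈ range i, ∑ l ∈ range j, entry A k l

section corner

variable {n : ℕ} (A B C : Matrix (Fin n) (Fin n) ℕ)

lemma entry_nonneg (k l : ℕ) : 0 ≤ entry A k l := by
  unfold entry; split_ifs <;> simp

lemma entry_fin (i j : Fin n) : entry A i j = A i j := by simp [entry]

lemma entry_eq (i j : ℕ) : entry A i j =
    corner A (i + 1) (j + 1) + corner A i j - corner A (i + 1) j - corner A i (j + 1) := by
  simp only [corner, sum_range_succ, sum_add_distrib]; ring

lemma corner_zero_left (j : ℕ) : corner A 0 j = 0 := by simp [corner]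

lemma corner_zero_right (i : ℕ) : corner A i 0 = 0 := by simp [corner]

lemma corner_super {i i' j j' : ℕ} (hi : i ≤ i') (hj : j ≤ j') :
    corner A i' j + corner A i j' ≤ corner A i' j' + corner A i j := by
  have hm : Monotone (fun i => corner A i j' - corner A i j) := by
    refine monotone_nat_of_le_succ fun k => ?_
    have : ∑ l ∈ range j, entry A k l ≤ ∑ l ∈ range j', entry A k l :=
      sum_le_sum_of_subset_of_nonneg (range_mono hj) fun l _ _ => entry_nonneg A k l
    simp only [corner, sum_range_succ]
    linarith
  have := hm hi
  simp only at this
  linarith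

lemma corner_mono_left {i i' : ℕ} (hi : i ≤ i') (j : ℕ) : corner A i j ≤ corner A i' j := by
  have := corner_super A hi (Nat.zero_le j)
  simp only [corner_zero_right] at this
  linarith

lemma corner_mono_right (i : ℕ) {j j' : ℕ} (hj : j ≤ j') : corner A i j ≤ corner A i j' := by
  have := corner_super A (Nat.zero_le i) hj
  simp only [corner_zero_left] at this
  linarith

lemma corner_sat_left {i : ℕ} (hi : n ≤ i) (j : ℕ) : corner A i j = corner A n j := by
  unfold corner
  symm
  refine sum_subset (range_mono hi) fun k _ hk => sum_eq_zero fun l _ => ?_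
  have : ¬ k < n := by simpa using hk
  simp [entry, this]

lemma corner_sat_right (i : ℕ) {j : ℕ} (hj : n ≤ j) : corner A i j = corner A i n := by
  unfold corner
  refine sum_congr rfl fun k _ => ?_
  symm
  refine sum_subset (range_mono hj) fun l _ hl => ?_
  have : ¬ l < n := by simpa using hl
  simp [entry, this]

lemma corner_le_n_left (i j : ℕ) : corner A i j ≤ corner A n j := by
  rcases le_total i n with h | h
  · exact corner_mono_left A h j
  · exact (corner_sat_left A h j).le

lemma corner_le_n_right (i j : ℕ) : corner A i j ≤ corner A i n := by
  rcases le_total j n with h | h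
  · exact corner_mono_right A i h
  · exact (corner_sat_right A i h).le

lemma corner_inj (h : ∀ i j, corner A i j = corner B i j) : A = B := by
  ext i j
  have : entry A i j = entry B i j := by simp only [entry_eq, h]
  simpa [entry_fin] using this

lemma sum_row (k : Fin n) : ∑ l ∈ range n, entry A k l = (ro A k : ℤ) := by
  rw [Finset.sum_range]; simp [entry, ro]

lemma sum_col (l : Fin n) : ∑ k ∈ range n, entry A k l = (co A l : ℤ) := by
  rw [Finset.sum_range]; simp [entry, co]

lemma rect_eq {i i' j j' : ℕ} (hi : i ≤ i') (hj : j ≤ j') :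
    corner A i' j' + corner A i j - corner A i' j - corner A i j' =
      ∑ k ∈ Ico i i', ∑ l ∈ Ico j j', entry A k l := by
  simp only [sum_Ico_eq_sub _ hj, sum_Ico_eq_sub _ hi, sum_sub_distrib, corner]
  ring

/-- The block sum of rows `i, …, i'-1` and columns `j, …, j'-1` vanishes iff all entries do. -/
lemma rect_eq_zero_iff {i i' j j' : ℕ} (hi : i ≤ i')
    (hj : j ≤ j') : corner A i' j' + corner A i j - corner A i' j - corner A i j' = 0 ↔
      ∀ s t : Fin n, i ≤ s → (s : ℕ) < i' → j ≤ t → (t : ℕ) < j' → A s t = 0 := by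
  rw [rect_eq A hi hj, sum_eq_zero_iff_of_nonneg
    (fun k _ => sum_nonneg fun l _ => entry_nonneg A k l)]
  constructor
  · intro h s t h1 h2 h3 h4
    have := (sum_eq_zero_iff_of_nonneg (fun l _ => entry_nonneg A s l)).1
      (h s (mem_Ico.2 ⟨h1, h2⟩)) t (mem_Ico.2 ⟨h3, h4⟩)
    rw [entry_fin] at this
    exact_mod_cast this
  · intro h s hs
    refine sum_eq_zero fun t ht => ?_
    rw [mem_Ico] at hs ht
    unfold entry
    split_ifs with hh
    · exact_mod_cast h ⟨s, hh.1⟩ ⟨t, hh.2⟩ hs.1 hs.2 ht.1 ht.2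
    · rfl

lemma corner_row (i : ℕ) (hi : i ≤ n) :
    corner A i n = ∑ k ∈ range i, (if h : k < n then (ro A ⟨k, h⟩ : ℤ) else 0) := by
  unfold corner
  refine sum_congr rfl fun k hk => ?_
  have h : k < n := lt_of_lt_of_le (by simpa using hk) hi
  rw [dif_pos h, ← sum_row]

lemma corner_col (j : ℕ) (hj : j ≤ n) :
    corner A n j = ∑ l ∈ range j, (if h : l < n then (co A ⟨l, h⟩ : ℤ) else 0) := by
  unfold corner
  rw [sum_comm]
  refine sum_congr rfl fun k hk => ?_
  have h : k < n := lt_of_lt_of_le (by simpa using hk) hj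
  rw [dif_pos h, ← sum_col]

variable {A B} in
lemma corner_compat (h : co A = ro B) (k : ℕ) : corner A n k = corner B k n := by
  rcases le_total k n with hk | hk
  · rw [corner_col A k hk, corner_row B k hk, h]
  · rw [corner_sat_right A n hk, corner_sat_left B hk, corner_col A n le_rfl,
      corner_row B n le_rfl, h]

lemma ro_eq_of_corner (h : ∀ i, corner A i n = corner B i n) : ro A = ro B := by
  ext i
  have hA := corner_row A (i + 1) i.2
  have hA' := corner_row A i i.2.le
  have hB := corner_row B (i + 1) i.2
  have hB' := corner_row B i i.2.le
  rw [sum_range_succ, ← hA', dif_pos i.2] at hA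
  rw [sum_range_succ, ← hB', dif_pos i.2] at hB
  have h1 := h (i + 1)
  have h2 := h i
  have : (ro A i : ℤ) = ro B i := by simp only [Fin.eta] at hA hB; linarith
  exact_mod_cast this

lemma co_eq_of_corner (h : ∀ j, corner A n j = corner B n j) : co A = co B := by
  ext i
  have hA := corner_col A (i + 1) i.2
  have hA' := corner_col A i i.2.le
  have hB := corner_col B (i + 1) i.2
  have hB' := corner_col B i i.2.le
  rw [sum_range_succ, ← hA', dif_pos i.2] at hA
  rw [sum_range_succ, ← hB', dif_pos i.2] at hB
  have h1 := h (i + 1)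
  have h2 := h i
  have : (co A i : ℤ) = co B i := by simp only [Fin.eta] at hA hB; linarith
  exact_mod_cast this

end corner

/-! ### The multiplication rule of the standard basis -/

/-- For flags `V, V', V''` with `(V, V')` in relative position `A` and `(V', V'')` in relative
position `B`, one has `dim (V_i ∩ V''_j) ≥ dim (V_i ∩ V'_k) + dim (V'_k ∩ V''_j) - dim V'_k` for
all `k`. The maximum over `k` of the right-hand side is the value of `dim (V_i ∩ V''_j)` for
generic such flags, that is, in the open orbit. -/
def prodCorner {n : ℕ} (A B : Matrix (Fin n) (Fin n) ℕ) (i j : ℕ) : ℤ :=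
  (range (n + 1)).sup' nonempty_range_add_one
    (fun k => corner A i k + corner B k j - corner B k n)

/-- The matrix `C` with `e_A e_B = e_C` (when `co A = ro B`): the matrix with corner sums
`prodCorner A B`; see `corner_mulMat`. -/
def mulMat {n : ℕ} (A B : Matrix (Fin n) (Fin n) ℕ) : Matrix (Fin n) (Fin n) ℕ := fun i j =>
  (prodCorner A B (i + 1) (j + 1) + prodCorner A B i j
    - prodCorner A B (i + 1) j - prodCorner A B i (j + 1)).toNat

section mul

variable {n : ℕ} {A B C : Matrix (Fin n) (Fin n) ℕ}

lemma le_prodCorner (A B : Matrix (Fin n) (Fin n) ℕ) (i j : ℕ) {k : ℕ} (hk : k ≤ n) :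
    corner A i k + corner B k j - corner B k n ≤ prodCorner A B i j :=
  le_sup' (fun k => corner A i k + corner B k j - corner B k n)
    (mem_range.2 (Nat.lt_succ_of_le hk))

lemma prodCorner_le {i j : ℕ} {x : ℤ}
    (h : ∀ k ≤ n, corner A i k + corner B k j - corner B k n ≤ x) : prodCorner A B i j ≤ x :=
  sup'_le _ _ fun k hk => h k (Nat.le_of_lt_succ (mem_range.1 hk))

lemma exists_prodCorner (A B : Matrix (Fin n) (Fin n) ℕ) (i j : ℕ) :
    ∃ k ≤ n, prodCorner A B i j = corner A i k + corner B k j - corner B k n := by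
  obtain ⟨k, hk, h⟩ := exists_mem_eq_sup' (nonempty_range_add_one (n := n))
    (fun k => corner A i k + corner B k j - corner B k n)
  exact ⟨k, Nat.le_of_lt_succ (mem_range.1 hk), h⟩

lemma prodCorner_zero_left (j : ℕ) : prodCorner A B 0 j = 0 := by
  apply le_antisymm
  · refine prodCorner_le fun k _ => ?_
    have := corner_le_n_right B k j
    rw [corner_zero_left]; linarith
  · have := le_prodCorner A B 0 j (Nat.zero_le n)
    simpa [corner_zero_left] using this

lemma prodCorner_zero_right (h : co A = ro B) (i : ℕ) : prodCorner A B i 0 = 0 := by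
  apply le_antisymm
  · refine prodCorner_le fun k _ => ?_
    have := corner_le_n_left A i k
    rw [corner_zero_right, ← corner_compat h]; linarith
  · have := le_prodCorner A B i 0 (Nat.zero_le n)
    simpa [corner_zero_left, corner_zero_right] using this

lemma prodCorner_n_left (h : co A = ro B) (j : ℕ) : prodCorner A B n j = corner B n j := by
  apply le_antisymm
  · refine prodCorner_le fun k _ => ?_
    have := corner_le_n_left B k j
    rw [corner_compat h]; linarith
  · have := le_prodCorner A B n j le_rfl
    rw [corner_compat h] at this; linarith

lemma prodCorner_n_right (i : ℕ) : prodCorner A B i n = corner A i n := by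
  apply le_antisymm
  · refine prodCorner_le fun k _ => ?_
    have := corner_le_n_right A i k
    linarith
  · have := le_prodCorner A B i n le_rfl
    linarith

lemma prodCorner_sat_left {i : ℕ} (hi : n ≤ i) (j : ℕ) :
    prodCorner A B i j = prodCorner A B n j := by
  unfold prodCorner
  congr 1
  funext k
  rw [corner_sat_left A hi]

lemma prodCorner_sat_right (i : ℕ) {j : ℕ} (hj : n ≤ j) :
    prodCorner A B i j = prodCorner A B i n := by
  unfold prodCorner
  congr 1
  funext k
  rw [corner_sat_right B k hj]

lemma prodCorner_super (A B : Matrix (Fin n) (Fin n) ℕ) (i j : ℕ) :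
    prodCorner A B (i + 1) j + prodCorner A B i (j + 1) ≤
      prodCorner A B (i + 1) (j + 1) + prodCorner A B i j := by
  obtain ⟨k, hk, h⟩ := exists_prodCorner A B (i + 1) j
  obtain ⟨k', hk', h'⟩ := exists_prodCorner A B i (j + 1)
  rw [h, h']
  rcases le_total k k' with hkk | hkk
  · have h1 := le_prodCorner A B (i + 1) (j + 1) hk'
    have h2 := le_prodCorner A B i j hk
    have h3 := corner_super A (Nat.le_succ i) hkk
    simp only [Nat.succ_eq_add_one] at h3
    linarith
  · have h1 := le_prodCorner A B (i + 1) (j + 1) hk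
    have h2 := le_prodCorner A B i j hk'
    have h3 := corner_super B hkk (Nat.le_succ j)
    simp only [Nat.succ_eq_add_one] at h3
    linarith

lemma entry_mulMat (A B : Matrix (Fin n) (Fin n) ℕ) (i j : ℕ) : entry (mulMat A B) i j =
    prodCorner A B (i + 1) (j + 1) + prodCorner A B i j
      - prodCorner A B (i + 1) j - prodCorner A B i (j + 1) := by
  unfold entry
  split_ifs with h
  · have := prodCorner_super A B i j
    simp only [mulMat]
    rw [Int.toNat_of_nonneg (by linarith)]
  · rcases not_and_or.1 h with h | h
    · have h : n ≤ i := not_lt.1 h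
      rw [prodCorner_sat_left h, prodCorner_sat_left h, prodCorner_sat_left (Nat.le_succ_of_le h),
        prodCorner_sat_left (Nat.le_succ_of_le h)]
      ring
    · have h : n ≤ j := not_lt.1 h
      rw [prodCorner_sat_right _ h, prodCorner_sat_right _ h,
        prodCorner_sat_right _ (Nat.le_succ_of_le h), prodCorner_sat_right _ (Nat.le_succ_of_le h)]
      ring

lemma corner_mulMat (h : co A = ro B) (i j : ℕ) :
    corner (mulMat A B) i j = prodCorner A B i j := by
  have hrow : ∀ k, ∑ l ∈ range j, entry (mulMat A B) k l =
      prodCorner A B (k + 1) j - prodCorner A B k j := by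
    intro k
    induction j with
    | zero => simp [prodCorner_zero_right h]
    | succ j ih => rw [sum_range_succ, ih, entry_mulMat]; ring
  unfold corner
  simp only [hrow]
  rw [sum_range_sub (fun k => prodCorner A B k j), prodCorner_zero_left, sub_zero]

lemma ro_mulMat (h : co A = ro B) : ro (mulMat A B) = ro A :=
  ro_eq_of_corner _ _ fun i => by rw [corner_mulMat h, prodCorner_n_right]

lemma co_mulMat (h : co A = ro B) : co (mulMat A B) = co B :=
  co_eq_of_corner _ _ fun j => by rw [corner_mulMat h, prodCorner_n_left h]

lemma mulMat_assoc (h : co A = ro B) (h' : co B = ro C) :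
    mulMat (mulMat A B) C = mulMat A (mulMat B C) := by
  have h1 : co (mulMat A B) = ro C := (co_mulMat h).trans h'
  have h2 : co A = ro (mulMat B C) := h.trans (ro_mulMat h').symm
  refine corner_inj _ _ fun i j => ?_
  rw [corner_mulMat h1, corner_mulMat h2]
  apply le_antisymm
  · refine prodCorner_le fun k hk => ?_
    rw [corner_mulMat h]
    obtain ⟨l, hl, e⟩ := exists_prodCorner A B i k
    have h3 := le_prodCorner A (mulMat B C) i j hl
    have h4 := le_prodCorner B C l j hk
    rw [corner_mulMat h', corner_mulMat h', prodCorner_n_right] at h3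
    linarith
  · refine prodCorner_le fun l hl => ?_
    rw [corner_mulMat h', corner_mulMat h', prodCorner_n_right]
    obtain ⟨k, hk, e⟩ := exists_prodCorner B C l j
    have h3 := le_prodCorner (mulMat A B) C i j hk
    have h4 := le_prodCorner A B i k hl
    rw [corner_mulMat h] at h3
    linarith

lemma ro_diagonal (l : Fin n → ℕ) : ro (Matrix.diagonal l) = l := by
  ext i; simp [ro, Matrix.diagonal_apply]

lemma co_diagonal (l : Fin n → ℕ) : co (Matrix.diagonal l) = l := by
  ext i; simp [co, Matrix.diagonal_apply]

lemma corner_diagonal (l : Fin n → ℕ) (i j : ℕ) : corner (Matrix.diagonal l) i j =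
    ∑ k ∈ range (min i j), (if h : k < n then (l ⟨k, h⟩ : ℤ) else 0) := by
  have he : ∀ k m, entry (Matrix.diagonal l) k m =
      if k = m then (if h : k < n then (l ⟨k, h⟩ : ℤ) else 0) else 0 := by
    intro k m
    unfold entry
    by_cases hk : k < n <;> by_cases hm : m < n <;> by_cases e : k = m <;>
      simp_all
  have hf : (range i).filter (fun k => k < j) = range (min i j) := by
    ext k; simp
  unfold corner
  simp only [he, sum_ite_eq, mem_range]
  rw [← sum_filter, hf]

lemma corner_diagonal_ro (A : Matrix (Fin n) (Fin n) ℕ) {i j : ℕ} (h : min i j ≤ n) :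
    corner (Matrix.diagonal (ro A)) i j = corner A (min i j) n := by
  rw [corner_diagonal, corner_row A _ h]

lemma corner_diagonal_co (A : Matrix (Fin n) (Fin n) ℕ) {i j : ℕ} (h : min i j ≤ n) :
    corner (Matrix.diagonal (co A)) i j = corner A n (min i j) := by
  rw [corner_diagonal, corner_col A _ h]

lemma diagonal_mulMat (A : Matrix (Fin n) (Fin n) ℕ) :
    mulMat (Matrix.diagonal (ro A)) A = A := by
  refine corner_inj _ _ fun i j => ?_
  rw [corner_mulMat (co_diagonal _)]
  apply le_antisymm
  · refine prodCorner_le fun k hk => ?_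
    rw [corner_diagonal_ro A ((min_le_right _ _).trans hk)]
    rcases le_total i k with h | h
    · rw [min_eq_left h]
      have h1 := corner_super A h (le_max_left j n)
      rw [corner_sat_right A _ (le_max_right j n), corner_sat_right A _ (le_max_right j n)] at h1
      linarith
    · rw [min_eq_right h]
      have := corner_mono_left A h j
      linarith
  · have h1 := le_prodCorner (Matrix.diagonal (ro A)) A i j (min_le_right i n)
    rw [corner_diagonal_ro A (by omega), min_eq_right (min_le_left i n)] at h1
    rcases le_total i n with h | h
    · rw [min_eq_left h] at h1; linarith
    · rw [min_eq_right h] at h1; rw [corner_sat_left A h]; linarith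

lemma mulMat_diagonal (A : Matrix (Fin n) (Fin n) ℕ) :
    mulMat A (Matrix.diagonal (co A)) = A := by
  have hc : co A = ro (Matrix.diagonal (co A)) := (ro_diagonal _).symm
  refine corner_inj _ _ fun i j => ?_
  rw [corner_mulMat hc]
  apply le_antisymm
  · refine prodCorner_le fun k hk => ?_
    rw [corner_diagonal_co A ((min_le_left _ _).trans hk), ← corner_compat hc]
    rcases le_total j k with h | h
    · rw [min_eq_right h]
      have h1 := corner_super A (le_max_left i n) h
      rw [corner_sat_left A (le_max_right i n), corner_sat_left A (le_max_right i n)] at h1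
      linarith
    · rw [min_eq_left h]
      have := corner_mono_right A i h
      linarith
  · have h1 := le_prodCorner A (Matrix.diagonal (co A)) i j (min_le_right j n)
    rw [corner_diagonal_co A (by omega), min_eq_left (min_le_left j n), ← corner_compat hc] at h1
    rcases le_total j n with h | h
    · rw [min_eq_left h] at h1; linarith
    · rw [min_eq_right h] at h1; rw [corner_sat_right A _ h]; linarith

lemma sum_mulMat (h : co A = ro B) :
    ∑ i, ∑ j, mulMat A B i j = ∑ i, ∑ j, A i j :=
  sum_congr rfl fun i _ => congrFun (ro_mulMat h) i

end mul

/-! ### The `0`-Schur algebra over `ℂ` -/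

/-- The product of two composable elements of `M_n(r)`. -/
def Mat.mul {n r : ℕ} (A B : Mat n r) (h : co A.1 = ro B.1) : Mat n r :=
  ⟨mulMat A.1 B.1, (sum_mulMat h).trans A.2⟩

/-- The diagonal matrix `D_λ`. -/
def diagMat {n r : ℕ} (l : WComp n r) : Mat n r :=
  ⟨Matrix.diagonal l.1, by
    have : ∀ i, ∑ j, Matrix.diagonal l.1 i j = l.1 i := fun i => congrFun (ro_diagonal l.1) i
    simp only [this]; exact l.2⟩

/-- The row-sum vector of `A ∈ M_n(r)` as a weak composition of `r`. -/
def Mat.row {n r : ℕ} (A : Mat n r) : WComp n r := ⟨ro A.1, A.2⟩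

/-- The column-sum vector of `A ∈ M_n(r)` as a weak composition of `r`. -/
def Mat.col {n r : ℕ} (A : Mat n r) : WComp n r := ⟨co A.1, sum_comm.trans A.2⟩

noncomputable section

/-- The `0`-Schur algebra over `ℂ`, through its standard basis: the vector space with basis `e_A`,
`A ∈ M_n(r)` (the orbits of pairs of `n`-step flags in an `r`-dimensional space), where
`e_A e_B = e_C` for the open orbit `C` among those composed of `A` and `B`, if `co A = ro B`, and
`e_A e_B = 0` otherwise. The unit is `∑_λ k_λ`. The products `e_i e_A` and `f_i e_A`, which
determine the algebra structure, are computed in `eGen_mul_e_move`, `eGen_mul_e_zero`,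
`fGen_mul_e_move` and `fGen_mul_e_zero`, and `k_λ e_A` and `e_A k_λ` in `k_mul_e`, `e_mul_k`. -/
def Schur (n r : ℕ) : Type := Mat n r →₀ ℂ

namespace Schur

variable {n r : ℕ}

instance : AddCommGroup (Schur n r) := inferInstanceAs (AddCommGroup (Mat n r →₀ ℂ))

instance : Module ℂ (Schur n r) := inferInstanceAs (Module ℂ (Mat n r →₀ ℂ))

/-- The standard basis element `e_A`. -/
def e (A : Mat n r) : Schur n r := Finsupp.single A (1 : ℂ)

/-- The standard basis as a basis. -/
def basis (n r : ℕ) : Module.Basis (Mat n r) ℂ (Schur n r) :=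
  Module.Basis.ofRepr (LinearEquiv.refl ℂ (Mat n r →₀ ℂ))

lemma basis_apply (A : Mat n r) : basis n r A = e A := rfl

open Classical in
/-- The product `e_A e_B`: it is `e_C` if `co A = ro B`, and `0` otherwise. -/
def basisMul (A B : Mat n r) : Schur n r :=
  if h : co A.1 = ro B.1 then e (A.mul B h) else 0

/-- The bilinear multiplication. -/
def mulLin (n r : ℕ) : Schur n r →ₗ[ℂ] Schur n r →ₗ[ℂ] Schur n r :=
  (basis n r).constr ℂ fun A => (basis n r).constr ℂ fun B => basisMul A B

instance : Mul (Schur n r) := ⟨fun x y => mulLin n r x y⟩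

/-- The idempotent `k_λ = e_{D_λ}`. -/
def k (l : WComp n r) : Schur n r := e (diagMat l)

instance : One (Schur n r) := ⟨∑ l : WComp n r, k l⟩

lemma mul_def (x y : Schur n r) : x * y = mulLin n r x y := rfl

lemma one_def : (1 : Schur n r) = ∑ l : WComp n r, k l := rfl

lemma e_mul_e (A B : Mat n r) : e A * e B = basisMul A B := by
  rw [mul_def, ← basis_apply A, ← basis_apply B, mulLin, Module.Basis.constr_basis,
    Module.Basis.constr_basis]

lemma e_mul_e_of_eq {A B : Mat n r} (h : co A.1 = ro B.1) : e A * e B = e (A.mul B h) := by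
  rw [e_mul_e, basisMul, dif_pos h]

lemma e_mul_e_of_ne {A B : Mat n r} (h : co A.1 ≠ ro B.1) : e A * e B = 0 := by
  rw [e_mul_e, basisMul, dif_neg h]

lemma k_mul_e (l : WComp n r) (A : Mat n r) : k l * e A = if l = A.row then e A else 0 := by
  split_ifs with h
  · subst h
    rw [k, e_mul_e_of_eq (co_diagonal _)]
    exact congrArg e (Subtype.ext (diagonal_mulMat A.1))
  · exact e_mul_e_of_ne fun h' => h (Subtype.ext ((co_diagonal l.1).symm.trans h'))

lemma e_mul_k (l : WComp n r) (A : Mat n r) : e A * k l = if l = A.col then e A else 0 := by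
  split_ifs with h
  · subst h
    rw [k, e_mul_e_of_eq (ro_diagonal _).symm]
    exact congrArg e (Subtype.ext (mulMat_diagonal A.1))
  · exact e_mul_e_of_ne fun h' => h (Subtype.ext ((ro_diagonal l.1).symm.trans h'.symm))

lemma e_mul_assoc (A B C : Mat n r) : e A * e B * e C = e A * (e B * e C) := by
  by_cases h : co A.1 = ro B.1
  · by_cases h' : co B.1 = ro C.1
    · have h1 : co (A.mul B h).1 = ro C.1 := (co_mulMat h).trans h'
      have h2 : co A.1 = ro (B.mul C h').1 := h.trans (ro_mulMat h').symm
      rw [e_mul_e_of_eq h, e_mul_e_of_eq h', e_mul_e_of_eq h1, e_mul_e_of_eq h2]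
      exact congrArg e (Subtype.ext (mulMat_assoc h h'))
    · have h1 : co (A.mul B h).1 ≠ ro C.1 := fun h1 => h' ((co_mulMat h).symm.trans h1)
      rw [e_mul_e_of_eq h, e_mul_e_of_ne h', e_mul_e_of_ne h1, mul_def, map_zero]
  · rw [e_mul_e_of_ne h, mul_def 0, map_zero, LinearMap.zero_apply]
    by_cases h' : co B.1 = ro C.1
    · have h2 : co A.1 ≠ ro (B.mul C h').1 := fun h2 => h (h2.trans (ro_mulMat h'))
      rw [e_mul_e_of_eq h', e_mul_e_of_ne h2]
    · rw [e_mul_e_of_ne h', mul_def, map_zero]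

@[elab_as_elim]
lemma schur_induction {p : Schur n r → Prop} (x : Schur n r) (zero : p 0)
    (add : ∀ x y, p x → p y → p (x + y)) (smul : ∀ (c : ℂ) A, p (c • e A)) : p x := by
  refine Finsupp.induction_linear x zero add fun A c => ?_
  have : Finsupp.single A c = c • (Finsupp.single A 1 : Mat n r →₀ ℂ) := by
    rw [Finsupp.smul_single, smul_eq_mul, mul_one]
  rw [this]
  exact smul c A

instance : Ring (Schur n r) :=
  { (inferInstance : AddCommGroup (Schur n r)),
    (inferInstance : Mul (Schur n r)),
    (inferInstance : One (Schur n r)) with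
    left_distrib := fun x y z => by simp only [mul_def, map_add]
    right_distrib := fun x y z => by simp only [mul_def, map_add, LinearMap.add_apply]
    zero_mul := fun x => by simp only [mul_def, map_zero, LinearMap.zero_apply]
    mul_zero := fun x => by simp only [mul_def, map_zero]
    mul_assoc := fun x y z => by
      induction x using schur_induction with
      | zero => simp only [mul_def, map_zero, LinearMap.zero_apply]
      | add x x' hx hx' =>
        simp only [mul_def, map_add, LinearMap.add_apply] at hx hx' ⊢; rw [hx, hx']
      | smul c A =>
      induction y using schur_induction with
      | zero => simp only [mul_def, map_zero, LinearMap.zero_apply]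
      | add y y' hy hy' =>
        simp only [mul_def, map_add, LinearMap.add_apply] at hy hy' ⊢; rw [hy, hy']
      | smul c' B =>
      induction z using schur_induction with
      | zero => simp only [mul_def, map_zero]
      | add z z' hz hz' =>
        simp only [mul_def, map_add] at hz hz' ⊢; rw [hz, hz']
      | smul c'' C =>
        have := e_mul_assoc A B C
        simp only [mul_def, map_smul, LinearMap.smul_apply] at this ⊢
        rw [this]
    one_mul := fun x => by
      have h : mulLin n r 1 = LinearMap.id := (basis n r).ext fun A => by
        have := fun l => k_mul_e l A
        simp only [mul_def] at this
        rw [one_def, map_sum, LinearMap.sum_apply, basis_apply]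
        simp [this]
      simp only [mul_def, h, LinearMap.id_apply]
    mul_one := fun x => by
      have h : (mulLin n r).flip 1 = LinearMap.id := (basis n r).ext fun A => by
        have := fun l => e_mul_k l A
        simp only [mul_def] at this
        rw [one_def, map_sum, LinearMap.sum_apply, basis_apply]
        simp [this]
      exact LinearMap.congr_fun h x }

instance : Algebra ℂ (Schur n r) :=
  Algebra.ofModule
    (fun c x y => by simp only [mul_def, map_smul, LinearMap.smul_apply])
    (fun c x y => by simp only [mul_def, map_smul])

/-- The row index `i` (the `i`-th row), for `i` in the index set `{1, …, n-1}` of the generators. -/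
def row₁ (i : Fin (n - 1)) : Fin n := ⟨i, by omega⟩

/-- The row index `i + 1`, for `i` in the index set `{1, …, n-1}` of the generators. -/
def row₂ (i : Fin (n - 1)) : Fin n := ⟨i + 1, by omega⟩

lemma sum_single (t c : Fin n) :
    ∑ i, ∑ j, (Matrix.single t c 1 : Matrix (Fin n) (Fin n) ℕ) i j = 1 := by
  simp [Matrix.single_apply, ite_and, Finset.sum_ite_eq]

lemma single_le {A : Matrix (Fin n) (Fin n) ℕ} {s c : Fin n} (h : 0 < A s c) (i j : Fin n) :
    (Matrix.single s c 1 : Matrix (Fin n) (Fin n) ℕ) i j ≤ A i j := by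
  rw [Matrix.single_apply]
  split_ifs with hh
  · obtain ⟨rfl, rfl⟩ := hh; exact h
  · exact Nat.zero_le _

lemma sum_move {A : Matrix (Fin n) (Fin n) ℕ} {s c : Fin n} (t : Fin n) (h : 0 < A s c) :
    ∑ i, ∑ j, (A - Matrix.single s c 1 + Matrix.single t c 1 : Matrix (Fin n) (Fin n) ℕ) i j = ∑ i, ∑ j, A i j := by
  have h1 : ∑ i, ∑ j, (A - Matrix.single s c 1 + Matrix.single t c 1 : Matrix (Fin n) (Fin n) ℕ) i j =
      ∑ i, ∑ j, (A - Matrix.single s c 1 : Matrix (Fin n) (Fin n) ℕ) i j + 1 := by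
    simp only [Matrix.add_apply, sum_add_distrib, sum_single]
  have h2 : ∑ i, ∑ j, (A - Matrix.single s c 1 : Matrix (Fin n) (Fin n) ℕ) i j + 1 =
      ∑ i, ∑ j, A i j := by
    refine (congrArg (_ + ·) (sum_single s c).symm).trans ?_
    simp only [← sum_add_distrib]
    exact sum_congr rfl fun i _ => sum_congr rfl fun j _ => Nat.sub_add_cancel (single_le h i j)
  exact h1.trans h2

/-- `A - E_{s,c} + E_{t,c}` for an entry `a_{s,c} > 0`: one unit of column `c` moves from row `s`
to row `t`. -/
def move (A : Mat n r) (s t c : Fin n) (h : 0 < A.1 s c) : Mat n r :=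
  ⟨A.1 - Matrix.single s c 1 + Matrix.single t c 1, (sum_move t h).trans A.2⟩

lemma diagMat_pos {l : WComp n r} {s : Fin n} (h : 0 < l.1 s) : 0 < (diagMat l).1 s s := by
  simpa [diagMat] using h

/-- `e_{i,λ}`, the basis element at `D_λ - E_{i+1,i+1} + E_{i,i+1}`; it is zero if
`λ_{i+1} = 0`, when this matrix has a negative entry. -/
def eGenAt (i : Fin (n - 1)) (l : WComp n r) : Schur n r :=
  if h : 0 < l.1 (row₂ i) then e (move (diagMat l) (row₂ i) (row₁ i) (row₂ i) (diagMat_pos h))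
  else 0

/-- `f_{i,λ}`, the basis element at `D_λ - E_{i,i} + E_{i+1,i}`; it is zero if `λ_i = 0`, when
this matrix has a negative entry. -/
def fGenAt (i : Fin (n - 1)) (l : WComp n r) : Schur n r :=
  if h : 0 < l.1 (row₁ i) then e (move (diagMat l) (row₁ i) (row₂ i) (row₁ i) (diagMat_pos h))
  else 0

/-- The generator `e_i = ∑_λ e_{i,λ}`. -/
def eGen (i : Fin (n - 1)) : Schur n r := ∑ l : WComp n r, eGenAt i l

/-- The generator `f_i = ∑_λ f_{i,λ}`. -/
def fGen (i : Fin (n - 1)) : Schur n r := ∑ l : WComp n r, fGenAt i l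

/-! The next facts are the multiplication rules for `e_i e_A` and `f_i e_A`. -/

lemma entry_move (A : Mat n r) (s t c : Fin n) (h : 0 < A.1 s c) (k l : ℕ) :
    entry (move A s t c h).1 k l = entry A.1 k l
      - (if k = s then if l = c then 1 else 0 else 0)
      + (if k = t then if l = c then 1 else 0 else 0) := by
  by_cases hh : k < n ∧ l < n
  · have h1 := single_le h ⟨k, hh.1⟩ ⟨l, hh.2⟩
    have h2 : (move A s t c h).1 ⟨k, hh.1⟩ ⟨l, hh.2⟩ = A.1 ⟨k, hh.1⟩ ⟨l, hh.2⟩ -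
      (Matrix.single s c 1 : Matrix (Fin n) (Fin n) ℕ) ⟨k, hh.1⟩ ⟨l, hh.2⟩ +
      (Matrix.single t c 1 : Matrix (Fin n) (Fin n) ℕ) ⟨k, hh.1⟩ ⟨l, hh.2⟩ := rfl
    have h3 : ∀ s : Fin n,
        (((Matrix.single s c 1 : Matrix (Fin n) (Fin n) ℕ) ⟨k, hh.1⟩ ⟨l, hh.2⟩ : ℕ) : ℤ) =
        if k = s then if l = c then 1 else 0 else 0 := by
      intro s
      rw [Matrix.single_apply, ← ite_and]
      simp only [Fin.ext_iff, eq_comm (a := (s : ℕ)), eq_comm (a := (c : ℕ))]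
      push_cast
      rfl
    rw [entry, dif_pos hh, entry, dif_pos hh, ← h3, ← h3, h2]
    push_cast [Nat.cast_sub h1]
    rfl
  · have h1 : ∀ s : Fin n, (if k = s then if l = c then (1 : ℤ) else 0 else 0) = 0 := by
      intro s
      split_ifs with h4 h5
      · exact absurd ⟨h4 ▸ s.2, h5 ▸ c.2⟩ hh
      · rfl
      · rfl
    rw [entry, dif_neg hh, entry, dif_neg hh, h1, h1]; rfl

lemma corner_move (A : Mat n r) (s t c : Fin n) (h : 0 < A.1 s c) (i j : ℕ) :
    corner (move A s t c h).1 i j = corner A.1 i j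
      - (if (s : ℕ) < i then if (c : ℕ) < j then 1 else 0 else 0)
      + (if (t : ℕ) < i then if (c : ℕ) < j then 1 else 0 else 0) := by
  have h1 : ∀ s c : ℕ, ∑ k ∈ range i, ∑ l ∈ range j,
      (if k = s then if l = c then (1 : ℤ) else 0 else 0) =
      if s < i then if c < j then 1 else 0 else 0 := by
    intro s c
    have h2 : ∀ k, ∑ l ∈ range j, (if k = s then if l = c then (1 : ℤ) else 0 else 0) =
        if k = s then if c < j then 1 else 0 else 0 := by
      intro k
      split_ifs with h3 h4 <;> simp_all
    simp only [h2, sum_ite_eq', mem_range]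
  simp only [corner, entry_move, sum_add_distrib, sum_sub_distrib, h1]

lemma ro_move_diagonal_ne {l : WComp n r} {s t c : Fin n} (h : 0 < (diagMat l).1 s c)
    {A : Mat n r} (hl : l ≠ A.row) : co (move (diagMat l) s t c h).1 ≠ ro A.1 := by
  intro h'
  refine hl (Subtype.ext ((co_diagonal l.1).symm.trans (Eq.trans ?_ h')))
  refine (co_eq_of_corner _ _ fun j => ?_).symm
  rw [corner_move, if_pos s.2, if_pos t.2, sub_add_cancel]
  rfl

lemma co_move_diagonal {A : Mat n r} {s t c : Fin n} (h : 0 < (diagMat A.row).1 s c) :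
    co (move (diagMat A.row) s t c h).1 = ro A.1 := by
  refine Eq.trans (co_eq_of_corner _ _ fun j => ?_) (co_diagonal _)
  rw [corner_move, if_pos s.2, if_pos t.2, sub_add_cancel]
  rfl

lemma eGen_mul_e (i : Fin (n - 1)) (A : Mat n r) :
    eGen i * e A = eGenAt i A.row * e A := by
  rw [eGen, sum_mul]
  refine sum_eq_single A.row (fun l _ hl => ?_) fun h => absurd (mem_univ _) h
  unfold eGenAt
  split_ifs with h
  · exact e_mul_e_of_ne (ro_move_diagonal_ne _ hl)
  · rw [zero_mul]

lemma fGen_mul_e (i : Fin (n - 1)) (A : Mat n r) :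
    fGen i * e A = fGenAt i A.row * e A := by
  rw [fGen, sum_mul]
  refine sum_eq_single A.row (fun l _ hl => ?_) fun h => absurd (mem_univ _) h
  unfold fGenAt
  split_ifs with h
  · exact e_mul_e_of_ne (ro_move_diagonal_ne _ hl)
  · rw [zero_mul]

/-- If row `i + 1` of `A` is zero, then `e_i e_A = 0`. -/
lemma eGen_mul_e_zero (i : Fin (n - 1)) (A : Mat n r) (h : ro A.1 (row₂ i) = 0) :
    eGen i * e A = 0 := by
  rw [eGen_mul_e, eGenAt, dif_neg (by simpa [Mat.row] using h), zero_mul]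

/-- If row `i` of `A` is zero, then `f_i e_A = 0`. -/
lemma fGen_mul_e_zero (i : Fin (n - 1)) (A : Mat n r) (h : ro A.1 (row₁ i) = 0) :
    fGen i * e A = 0 := by
  rw [fGen_mul_e, fGenAt, dif_neg (by simpa [Mat.row] using h), zero_mul]

lemma prodCorner_diag (A : Mat n r) (s j : ℕ) :
    prodCorner (diagMat A.row).1 A.1 s j = corner A.1 s j :=
  (corner_mulMat (co_diagonal _) s j).symm.trans (by
    rw [diagonal_mulMat A.1])

lemma diag_bound (A : Mat n r) (s j : ℕ) {k : ℕ} (hk : k ≤ n) :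
    corner (diagMat A.row).1 s k + corner A.1 k j - corner A.1 k n ≤ corner A.1 s j := by
  have h := le_prodCorner (diagMat A.row).1 A.1 s j hk
  rwa [prodCorner_diag] at h

lemma diag_attained (A : Mat n r) (s j : ℕ) : ∃ k ≤ n,
    corner (diagMat A.row).1 s k + corner A.1 k j - corner A.1 k n = corner A.1 s j := by
  obtain ⟨k, hk, h⟩ := exists_prodCorner (diagMat A.row).1 A.1 s j
  rw [prodCorner_diag] at h
  exact ⟨k, hk, h.symm⟩

lemma corner_diag (A : Mat n r) {s k : ℕ} (h : min s k ≤ n) :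
    corner (diagMat A.row).1 s k = corner A.1 (min s k) n := corner_diagonal_ro A.1 h

/-- If the last nonzero entry of row `i + 1` of `A` is in column `p`, then
`e_i e_A = e_B` with `B = A + E_{i,p} - E_{i+1,p}`. -/
lemma eGen_mul_e_move (i : Fin (n - 1)) (A : Mat n r) (p : Fin n) (hp : 0 < A.1 (row₂ i) p)
    (hmax : ∀ j, p < j → A.1 (row₂ i) j = 0) :
    eGen i * e A = e (move A (row₂ i) (row₁ i) p hp) := by
  have hpos : 0 < A.row.1 (row₂ i) :=
    lt_of_lt_of_le hp (single_le_sum (f := fun j => A.1 (row₂ i) j) (fun _ _ => Nat.zero_le _)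
      (mem_univ p))
  rw [eGen_mul_e, eGenAt, dif_pos hpos, e_mul_e_of_eq (co_move_diagonal _)]
  refine congrArg e (Subtype.ext (corner_inj _ _ fun s j => ?_))
  have hi : (i : ℕ) + 1 < n := by omega
  have key : ∀ k, corner (move (diagMat A.row) (row₂ i) (row₁ i) (row₂ i)
      (diagMat_pos hpos)).1 s k = corner (diagMat A.row).1 s k +
        if s = i + 1 ∧ i + 1 < k then 1 else 0 := by
    intro k
    rw [corner_move]
    simp only [row₁, row₂]
    split_ifs <;> omega
  have goal : corner (move A (row₂ i) (row₁ i) p hp).1 s j = corner A.1 s j +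
        if s = i + 1 ∧ (p : ℕ) < j then 1 else 0 := by
    rw [corner_move]
    simp only [row₁, row₂]
    split_ifs <;> omega
  refine (corner_mulMat (co_move_diagonal _) s j).trans ?_
  rw [goal]
  apply le_antisymm
  · refine prodCorner_le fun k hk => ?_
    rw [key]
    have hb := diag_bound A s j hk
    by_cases hs : s = i + 1 ∧ (i : ℕ) + 1 < k
    · rw [if_pos hs]
      by_cases hj : (p : ℕ) < j
      · rw [if_pos ⟨hs.1, hj⟩]; linarith
      · rw [if_neg fun h => hj h.2]
        have hjn : j ≤ n := by omega
        have hsk : s ≤ k := by omega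
        have h1 := corner_super A.1 hsk hjn
        have h2 := (rect_eq_zero_iff A.1 hsk hjn).not.2 fun h => by
          have := h (row₂ i) p (by simp [row₂, hs.1]) (by simp [row₂, hs.2]) (by omega) p.2
          omega
        rw [corner_diag A (by omega), min_eq_left hsk]
        omega
    · rw [if_neg hs]
      split_ifs <;> linarith
  · by_cases hs : s = i + 1 ∧ (p : ℕ) < j
    · rw [if_pos hs]
      obtain ⟨rfl, hj⟩ := hs
      have h1 := le_prodCorner (move (diagMat A.row) (row₂ i) (row₁ i) (row₂ i)
        (diagMat_pos hpos)).1 A.1 (i + 1) j (k := i + 2) (by omega)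
      rw [key, if_pos ⟨rfl, by omega⟩, corner_diag A (by omega), min_eq_left (by omega)] at h1
      refine le_trans ?_ h1
      rcases le_total j n with hjn | hjn
      · have h2 := (rect_eq_zero_iff A.1 (Nat.le_succ (i + 1)) hjn).2 fun a b ha ha' hb hb' => by
          have : a = row₂ i := Fin.ext (by simp only [row₂]; omega)
          subst this
          exact hmax b (Fin.lt_def.2 (by omega))
        simp only [Nat.succ_eq_add_one] at h2
        have : (i : ℕ) + 1 + 1 = i + 2 := rfl
        rw [this] at h2
        omega
      · rw [corner_sat_right A.1 _ hjn, corner_sat_right A.1 _ hjn]; omega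
    · rw [if_neg hs]
      obtain ⟨k, hk, h⟩ := diag_attained A s j
      have h1 := le_prodCorner (move (diagMat A.row) (row₂ i) (row₁ i) (row₂ i)
        (diagMat_pos hpos)).1 A.1 s j hk
      rw [key] at h1
      split_ifs at h1 <;> omega

/-- If the first nonzero entry of row `i` of `A` is in column `q`, then
`f_i e_A = e_B` with `B = A - E_{i,q} + E_{i+1,q}`. -/
lemma fGen_mul_e_move (i : Fin (n - 1)) (A : Mat n r) (q : Fin n) (hq : 0 < A.1 (row₁ i) q)
    (hmin : ∀ j, j < q → A.1 (row₁ i) j = 0) :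
    fGen i * e A = e (move A (row₁ i) (row₂ i) q hq) := by
  have hpos : 0 < A.row.1 (row₁ i) :=
    lt_of_lt_of_le hq (single_le_sum (f := fun j => A.1 (row₁ i) j) (fun _ _ => Nat.zero_le _)
      (mem_univ q))
  rw [fGen_mul_e, fGenAt, dif_pos hpos, e_mul_e_of_eq (co_move_diagonal _)]
  refine congrArg e (Subtype.ext (corner_inj _ _ fun s j => ?_))
  have hi : (i : ℕ) + 1 < n := by omega
  have key : ∀ k, corner (move (diagMat A.row) (row₁ i) (row₂ i) (row₁ i)
      (diagMat_pos hpos)).1 s k = corner (diagMat A.row).1 s k -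
        if s = i + 1 ∧ (i : ℕ) < k then 1 else 0 := by
    intro k
    rw [corner_move]
    simp only [row₁, row₂]
    split_ifs <;> omega
  have goal : corner (move A (row₁ i) (row₂ i) q hq).1 s j = corner A.1 s j -
        if s = i + 1 ∧ (q : ℕ) < j then 1 else 0 := by
    rw [corner_move]
    simp only [row₁, row₂]
    split_ifs <;> omega
  refine (corner_mulMat (co_move_diagonal _) s j).trans ?_
  rw [goal]
  apply le_antisymm
  · refine prodCorner_le fun k hk => ?_
    rw [key]
    have hb := diag_bound A s j hk
    by_cases hs : s = i + 1 ∧ (q : ℕ) < j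
    · rw [if_pos hs]
      by_cases hk' : (i : ℕ) < k
      · rw [if_pos ⟨hs.1, hk'⟩]; linarith
      · rw [if_neg fun h => hk' h.2]
        have hks : k ≤ s := by omega
        have h1 := corner_mono_left A.1 hks j
        have h2 := (rect_eq_zero_iff A.1 hks (Nat.zero_le j)).not.2 fun h => by
          have := h (row₁ i) q (by simp only [row₁]; omega) (by simp only [row₁]; omega)
            (Nat.zero_le _) hs.2
          omega
        rw [corner_zero_right, corner_zero_right] at h2
        rw [corner_diag A (by omega), min_eq_right hks]
        omega
    · rw [if_neg hs]
      split_ifs <;> linarith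
  · by_cases hs : s = i + 1 ∧ ¬ (q : ℕ) < j
    · obtain ⟨rfl, hj⟩ := hs
      rw [if_neg fun h => hj h.2]
      have h1 := le_prodCorner (move (diagMat A.row) (row₁ i) (row₂ i) (row₁ i)
        (diagMat_pos hpos)).1 A.1 (i + 1) j (k := i) (by omega)
      rw [key, if_neg (by omega), corner_diag A (by omega), min_eq_right (by omega)] at h1
      have h2 := (rect_eq_zero_iff A.1 (Nat.le_succ i) (Nat.zero_le j)).2
        fun a b ha ha' hb hb' => by
          have : a = row₁ i := Fin.ext (by simp only [row₁]; omega)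
          subst this
          exact hmin b (Fin.lt_def.2 (by omega))
      rw [corner_zero_right, corner_zero_right] at h2
      simp only [Nat.succ_eq_add_one] at h2
      omega
    · obtain ⟨k, hk, h⟩ := diag_attained A s j
      have h1 := le_prodCorner (move (diagMat A.row) (row₁ i) (row₂ i) (row₁ i)
        (diagMat_pos hpos)).1 A.1 s j hk
      rw [key] at h1
      split_ifs at h1 ⊢ <;> omega

end Schur

/-! ### The modules `P_λ`, `N_λ` and `S_λ` -/

open Schur

variable {n r : ℕ}

/-- `α` is maximal with respect to `λ`: each of the consecutive subsequences into which `α` cuts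
`λ` is either `(0)`, or has neither its first nor its last entry equal to zero. -/
def IsMaximal (l : WComp n r) (α : Composition n) : Prop :=
  ∀ v : Fin α.length,
    (α.blocksFun v = 1 ∧ ∀ t, l.1 (α.embedding v t) = 0) ∨
    ((∀ t : Fin (α.blocksFun v), (t : ℕ) = 0 → l.1 (α.embedding v t) ≠ 0) ∧
      (∀ t : Fin (α.blocksFun v), (t : ℕ) + 1 = α.blocksFun v → l.1 (α.embedding v t) ≠ 0))

/-- The matrix `A(α;v)`: the columns of `A` in the `v`-th block of `α`, the other ones being
replaced by zero. -/
def colPart (A : Matrix (Fin n) (Fin n) ℕ) (α : Composition n) (v : Fin α.length) :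
    Matrix (Fin n) (Fin n) ℕ := fun i j =>
  if α.sizeUpTo v ≤ j ∧ (j : ℕ) < α.sizeUpTo (v + 1) then A i j else 0

/-- Open matrices: every `2 × 2` submatrix has at least one zero on its diagonal. -/
def IsOpenMat (A : Matrix (Fin n) (Fin n) ℕ) : Prop :=
  ∀ i i' j j' : Fin n, i < i' → j < j' → A i j = 0 ∨ A i' j' = 0

/-- `A` is open on columns with respect to `α`. -/
def IsOpenOnColumns (A : Matrix (Fin n) (Fin n) ℕ) (α : Composition n) : Prop :=
  ∀ v, IsOpenMat (colPart A α v)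

/-- The index set of `B^{λ,α}`: the matrices `A` with `co A = λ` that are open on columns with
respect to `α`. -/
def openSet (l : WComp n r) (α : Composition n) : Set (Mat n r) :=
  {A | co A.1 = l.1 ∧ IsOpenOnColumns A.1 α}

/-- The index set of `B^λ`: the matrices `A` with `co A = λ` such that `A` is not in the index set
of `B^{λ,α}` for any `α ≠ (1,…,1)` maximal with respect to `λ`. -/
def BSet (l : WComp n r) : Set (Mat n r) :=
  {A | co A.1 = l.1} \ ⋃ α ∈ {α : Composition n | IsMaximal l α} \ {Composition.ones n}, openSet l α

/-- Column block diagonal matrices. -/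
def IsColumnBlockDiagonal (A : Matrix (Fin n) (Fin n) ℕ) : Prop :=
  ∀ i j, 0 < A i j → ∀ s t, s ≤ i → j < t → A s t = 0

/-- `CB(λ)`: column block diagonal matrices with column-sum vector `λ`. -/
def CB (l : WComp n r) : Set (Mat n r) :=
  {A | IsColumnBlockDiagonal A.1 ∧ co A.1 = l.1}

/-- If `e_X e_A = e_C` with `C` column block diagonal, then `A` is column block diagonal. -/
lemma IsColumnBlockDiagonal.of_mulMat {X A : Matrix (Fin n) (Fin n) ℕ} (h : co X = ro A)
    (hC : IsColumnBlockDiagonal (mulMat X A)) : IsColumnBlockDiagonal A := by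
  intro i j hij s t hs ht
  -- a row cut of `C` adapted to the column cut `j + 1`
  obtain ⟨i₀, hi₀, h1, h2⟩ : ∃ i₀ ≤ n,
      (∀ a b : Fin n, i₀ ≤ a → (b : ℕ) < j + 1 → mulMat X A a b = 0) ∧
      (∀ a b : Fin n, (a : ℕ) < i₀ → (j : ℕ) + 1 ≤ b → mulMat X A a b = 0) := by
    classical
    let S := univ.filter fun a : Fin n => ∃ b : Fin n, (b : ℕ) < j + 1 ∧ 0 < mulMat X A a b
    refine ⟨S.sup fun a => (a : ℕ) + 1, Finset.sup_le fun a _ => a.2, ?_, ?_⟩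
    · intro a b ha hb
      by_contra hne
      have hmem : a ∈ S := mem_filter.2 ⟨mem_univ _, b, hb, Nat.pos_of_ne_zero hne⟩
      have := Finset.le_sup (f := fun a : Fin n => (a : ℕ) + 1) hmem
      omega
    · intro a b ha hb
      obtain ⟨a', ha', hlt⟩ := (Finset.lt_sup_iff).1 ha
      obtain ⟨b', hb', hpos⟩ := (mem_filter.1 ha').2
      exact hC a' b' hpos a b (Fin.le_def.2 (by omega)) (Fin.lt_def.2 (by omega))
  have h1' := (rect_eq_zero_iff (mulMat X A) hi₀ (Nat.zero_le (j + 1))).2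
    fun a b ha _ _ hb => h1 a b ha hb
  have h2' := (rect_eq_zero_iff (mulMat X A) (Nat.zero_le i₀) (Nat.succ_le_of_lt j.2)).2
    fun a b _ ha hb _ => h2 a b ha hb
  simp only [Nat.succ_eq_add_one, corner_mulMat h, prodCorner_n_left h, prodCorner_zero_left,
    prodCorner_zero_right h, corner_zero_right] at h1' h2'
  obtain ⟨k, hk, hk'⟩ := exists_prodCorner X A i₀ (j + 1)
  have h3 := le_prodCorner X A i₀ n hk
  have h4 := corner_le_n_left X i₀ k
  rw [corner_compat h] at h4
  have h5 := corner_le_n_left A k (j + 1)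
  have h6 := corner_le_n_right A k (j + 1)
  have hik : (i : ℕ) < k := by
    by_contra hlt
    have := (rect_eq_zero_iff A hk (Nat.zero_le (j + 1))).1
      (by rw [corner_zero_right, corner_zero_right]; linarith) i j (not_lt.1 hlt) i.2
      (Nat.zero_le _) (Nat.lt_succ_self _)
    omega
  exact (rect_eq_zero_iff A (Nat.zero_le k) (Nat.succ_le_of_lt j.2)).1
    (by rw [corner_zero_left, corner_zero_left]; simp only [Nat.succ_eq_add_one]; linarith) s t
    (Nat.zero_le _) (lt_of_le_of_lt hs hik) ht t.2

lemma isOpenMat_colPart_iff (A : Matrix (Fin n) (Fin n) ℕ) (α : Composition n)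
    (v : Fin α.length) : IsOpenMat (colPart A α v) ↔
      ∀ i j, i ≤ n → α.sizeUpTo v ≤ j → j ≤ α.sizeUpTo (v + 1) →
        (corner A i j = corner A i (α.sizeUpTo v) ∨
          corner A i (α.sizeUpTo (v + 1)) - corner A i j =
            corner A n (α.sizeUpTo (v + 1)) - corner A n j) := by
  constructor
  · intro h i j hi hj hj'
    by_contra hne
    rw [not_or] at hne
    have h1 := (rect_eq_zero_iff A (Nat.zero_le i) hj).not.1
      (by simp only [corner_zero_left]; exact fun h' => hne.1 (by linarith))
    have h2 := (rect_eq_zero_iff A hi hj').not.1 fun h' => hne.2 (by linarith)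
    push Not at h1 h2
    obtain ⟨s, t, _, hs, ht, ht', hst⟩ := h1
    obtain ⟨s', t', hs', _, ht1, ht1', hst'⟩ := h2
    rcases h s s' t t' (Fin.lt_def.2 (by omega)) (Fin.lt_def.2 (by omega)) with h | h
    · rw [colPart, if_pos ⟨ht, by omega⟩] at h; exact hst h
    · rw [colPart, if_pos ⟨by omega, ht1'⟩] at h; exact hst' h
  · intro h i i' j j' hi hj
    rw [Fin.lt_def] at hi hj
    unfold colPart
    split_ifs with h1 h2
    · rcases h i' j' i'.2.le h2.1 h2.2.le with h | h
      · exact Or.inl ((rect_eq_zero_iff A (Nat.zero_le i') h2.1).1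
          (by simp only [corner_zero_left]; linarith) i j (Nat.zero_le _) hi h1.1 hj)
      · exact Or.inr ((rect_eq_zero_iff A i'.2.le h2.2.le).1
          (by linarith) i' j' le_rfl i'.2 le_rfl h2.2)
    · exact Or.inr rfl
    · exact Or.inl rfl
    · exact Or.inl rfl

/-- If `A` is open on columns and `e_X e_A = e_C`, then `C` is open on columns. -/
lemma IsOpenOnColumns.mulMat {X A : Matrix (Fin n) (Fin n) ℕ} (h : co X = ro A)
    {α : Composition n} (hA : IsOpenOnColumns A α) : IsOpenOnColumns (mulMat X A) α := by
  intro v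
  have hv := (isOpenMat_colPart_iff A α v).1 (hA v)
  rw [isOpenMat_colPart_iff]
  intro i j hi hj hj'
  have s1 := corner_mono_right (ZeroSchur.mulMat X A) i hj
  have s2 := corner_super (ZeroSchur.mulMat X A) hi hj'
  simp only [corner_mulMat h, prodCorner_n_left h] at s1 s2 ⊢
  obtain ⟨k, hk, hk'⟩ := exists_prodCorner X A i j
  rcases hv k j hk hj hj' with h1 | h1
  · left
    have := le_prodCorner X A i (α.sizeUpTo v) hk
    linarith
  · right
    have := le_prodCorner X A i (α.sizeUpTo (v + 1)) hk
    linarith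

/-- If `e_X e_A = e_C` with `C` in the index set of `B^λ`, then `A` is in it, too. -/
lemma BSet.of_mul {l : WComp n r} {X A : Mat n r} (h : co X.1 = ro A.1)
    (hC : X.mul A h ∈ BSet l) : A ∈ BSet l := by
  refine ⟨(co_mulMat h).symm.trans hC.1, fun hA => hC.2 ?_⟩
  simp only [Set.mem_iUnion] at hA ⊢
  obtain ⟨α, hα, h1, h2⟩ := hA
  exact ⟨α, hα, (co_mulMat h).trans h1, h2.mulMat h⟩

/-- The span of the `e_A` with `A` outside the index set of `B^λ`, a left ideal. -/
def QSub (l : WComp n r) : Submodule (Schur n r) (Schur n r) :=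
  { Submodule.span ℂ (e '' (BSet l)ᶜ) with
    smul_mem' := fun x y hy => by
      change x * y ∈ Submodule.span ℂ (e '' (BSet l)ᶜ)
      induction hy using Submodule.span_induction with
      | zero => rw [mul_zero]; exact zero_mem _
      | add y y' _ _ hy hy' => rw [mul_add]; exact add_mem hy hy'
      | smul c y _ hy => rw [mul_smul_comm]; exact Submodule.smul_mem _ _ hy
      | mem y hy =>
        obtain ⟨A, hA, rfl⟩ := hy
        induction x using schur_induction with
        | zero => rw [zero_mul]; exact zero_mem _
        | add x x' hx hx' => rw [add_mul]; exact add_mem hx hx'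
        | smul c X =>
          rw [smul_mul_assoc]
          refine Submodule.smul_mem _ _ ?_
          by_cases h : co X.1 = ro A.1
          · rw [e_mul_e_of_eq h]
            exact Submodule.subset_span ⟨_, fun hC => hA (BSet.of_mul h hC), rfl⟩
          · rw [e_mul_e_of_ne h]; exact zero_mem _ }

/-- `P_λ`: the `ℂ`-vector space with basis `B^λ`, on which `b ∈ S_0(n,r)` acts by multiplication
followed by deleting the basis elements outside `B^λ`, that is, the quotient of the left regular
module by the span of the `e_A` with `A` outside the index set of `B^λ`. -/
abbrev P (l : WComp n r) : Type := Schur n r ⧸ QSub l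

/-- The class of `e_A` in `P_λ`: the basis element of `P_λ` if `A` is in the index set of `B^λ`,
and `0` otherwise. -/
def pBar (l : WComp n r) (A : Mat n r) : P l := Submodule.Quotient.mk (e A)

/-- `N_λ`: the `ℂ`-span of `B^λ \ β^λ` in `P_λ`, a submodule. -/
def N (l : WComp n r) : Submodule (Schur n r) (P l) :=
  { Submodule.span ℂ (pBar l '' (BSet l \ CB l)) with
    smul_mem' := fun x y hy => by
      change x • y ∈ Submodule.span ℂ (pBar l '' (BSet l \ CB l))
      induction hy using Submodule.span_induction with
      | zero => rw [smul_zero]; exact zero_mem _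
      | add y y' _ _ hy hy' => rw [smul_add]; exact add_mem hy hy'
      | smul c y _ hy => rw [smul_algebra_smul_comm]; exact Submodule.smul_mem _ _ hy
      | mem y hy =>
        obtain ⟨A, hA, rfl⟩ := hy
        induction x using schur_induction with
        | zero => rw [zero_smul]; exact zero_mem _
        | add x x' hx hx' => rw [add_smul]; exact add_mem hx hx'
        | smul c X =>
          rw [smul_assoc]
          refine Submodule.smul_mem _ _ ?_
          change (Submodule.Quotient.mk (e X * e A) : P l) ∈ _
          by_cases h : co X.1 = ro A.1
          · rw [e_mul_e_of_eq h]
            by_cases hB : X.mul A h ∈ BSet l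
            · exact Submodule.subset_span ⟨_, ⟨hB, fun hC => hA.2
                ⟨hC.1.of_mulMat h, (co_mulMat h).symm.trans hC.2⟩⟩, rfl⟩
            · have h0 : (Submodule.Quotient.mk (e (X.mul A h)) : P l) = 0 :=
                (Submodule.Quotient.mk_eq_zero _).2 (Submodule.subset_span ⟨_, hB, rfl⟩)
              rw [h0]; exact zero_mem _
          · rw [e_mul_e_of_ne h, Submodule.Quotient.mk_zero]; exact zero_mem _ }

/-- `S_λ = P_λ / N_λ`. -/
abbrev S (l : WComp n r) : Type := P l ⧸ N l

/-- The class `ē_A` of `e_A` in `S_λ`. -/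
def eBar (l : WComp n r) (A : Mat n r) : S l := Submodule.Quotient.mk (pBar l A)

/-- The class `k̄_λ` of `k_λ = e_{D_λ}` in `S_λ`. -/
def kBar (l : WComp n r) : S l := eBar l (diagMat l)

end

end ZeroSchur

namespace ZeroSchur

open Finset Schur

/-!
A column block diagonal matrix has at most one nonzero entry in each row, and these entries move
weakly to the right as one goes down. The classes `ē_A` with `A ∈ CB(λ)` form a basis of `S_λ`, on
which `e_i` moves one unit from row `i + 1` to row `i` inside its column, the result being `0` when
the new matrix is no longer column block diagonal; `f_i` undoes this move. So `e_i` and `f_i` are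
mutually inverse partial injections of the basis, and so are a word in the `e_i` and the reversed
word in the `f_i`, which is (2).

Applying `e_i` adds one to the sum of the first `i` rows and preserves the other partial row sums.
Hence the row sums of `A` and `D_λ` determine how often `e_i` occurs in a word leading from `ē_A` to
`k̄_λ`, which is (3).

If no upward move of a unit of `A` is possible in `CB(λ)`, then the nonzero rows of `A` come first
and have their entries in strictly increasing columns. As the nonzero columns come first as well,
`A = D_λ`. Upward moves cannot go on forever, which gives (1).
-/

section PartialInversePair

variable {R M : Type*}

/-- `x` and `y` act on `T` as mutually inverse partial injections, where `0` encodes "undefined". -/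
structure IsPartialInversePair [SMul R M] [Zero M] (T : Set M) (x y : R) : Prop where
  mapsTo_left : Set.MapsTo (x • ·) T (insert 0 T)
  mapsTo_right : Set.MapsTo (y • ·) T (insert 0 T)
  smul_eq_iff : ∀ u ∈ T, ∀ v ∈ T, x • u = v ↔ y • v = u

lemma IsPartialInversePair.symm [SMul R M] [Zero M] {T : Set M} {x y : R}
    (h : IsPartialInversePair T x y) : IsPartialInversePair T y x :=
  ⟨h.mapsTo_right, h.mapsTo_left, fun u hu v hv => (h.smul_eq_iff v hv u hu).symm⟩

lemma isPartialInversePair_one [Monoid R] [Zero M] [MulAction R M] {T : Set M} :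
    IsPartialInversePair T (1 : R) 1 where
  mapsTo_left u hu := Or.inr (by simpa only [one_smul] using hu)
  mapsTo_right u hu := Or.inr (by simpa only [one_smul] using hu)
  smul_eq_iff u _ v _ := by simpa only [one_smul] using eq_comm

variable [MonoidWithZero R] [Zero M] [MulActionWithZero R M] {T : Set M} {x y x' y' : R}

lemma mapsTo_mul_smul_insert_zero (hx : Set.MapsTo (x • ·) T (insert 0 T))
    (hx' : Set.MapsTo (x' • ·) T (insert 0 T)) :
    Set.MapsTo ((x * x') • ·) T (insert 0 T) := by
  intro u hu
  simp only [mul_smul]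
  rcases hx' hu with hzero | hmem
  · exact Or.inl (by rw [show x' • u = 0 from hzero, smul_zero])
  · exact hx hmem

lemma smul_mem_of_mul_smul_mem (hT : 0 ∉ T) (hx' : Set.MapsTo (x' • ·) T (insert 0 T)) {u : M}
    (hu : u ∈ T) (h : (x * x') • u ∈ T) : x' • u ∈ T :=
  (hx' hu).resolve_left fun hzero => hT <| by
    rwa [mul_smul, show x' • u = 0 from hzero, smul_zero] at h

namespace IsPartialInversePair

lemma mul_smul_eq (hT : 0 ∉ T) (h : IsPartialInversePair T x y)
    (h' : IsPartialInversePair T x' y') {u v : M} (hu : u ∈ T) (hv : v ∈ T)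
    (huv : (x * x') • u = v) : (y' * y) • v = u := by
  have hmid : x' • u ∈ T := smul_mem_of_mul_smul_mem hT h'.mapsTo_left hu (huv ▸ hv)
  rw [mul_smul] at huv ⊢
  rw [(h.smul_eq_iff _ hmid v hv).1 huv]
  exact (h'.smul_eq_iff u hu _ hmid).1 rfl

lemma mul (hT : 0 ∉ T) (h : IsPartialInversePair T x y) (h' : IsPartialInversePair T x' y') :
    IsPartialInversePair T (x * x') (y' * y) where
  mapsTo_left := mapsTo_mul_smul_insert_zero h.mapsTo_left h'.mapsTo_left
  mapsTo_right := mapsTo_mul_smul_insert_zero h'.mapsTo_right h.mapsTo_right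
  smul_eq_iff _ hu _ hv := ⟨mul_smul_eq hT h h' hu hv, mul_smul_eq hT h'.symm h.symm hv hu⟩

lemma list_prod {ι : Type*} {a b : ι → R} (hT : 0 ∉ T)
    (h : ∀ i, IsPartialInversePair T (a i) (b i)) (w : List ι) :
    IsPartialInversePair T (w.map a).prod (w.reverse.map b).prod := by
  induction w with
  | nil => exact isPartialInversePair_one
  | cons i w ih => simpa using (h i).mul hT ih

end IsPartialInversePair

end PartialInversePair

variable {n r : ℕ}

section RowColumnSums

variable (A B : Matrix (Fin n) (Fin n) ℕ) (s c : Fin n)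

lemma ro_add : ro (A + B) = ro A + ro B := by
  ext i
  simp only [ro, Matrix.add_apply, sum_add_distrib, Pi.add_apply]

lemma co_add : co (A + B) = co A + co B := by
  ext j
  simp only [co, Matrix.add_apply, sum_add_distrib, Pi.add_apply]

lemma ro_single : ro (Matrix.single s c 1) = Pi.single s 1 := by
  ext i
  simp [ro, Matrix.single_apply, Pi.single_apply, ite_and, eq_comm]

lemma co_single : co (Matrix.single s c 1) = Pi.single c 1 := by
  ext j
  simp [co, Matrix.single_apply, Pi.single_apply, ite_and, eq_comm]

variable {A s c}

lemma exists_pos_of_ro_ne_zero (h : ro A s ≠ 0) : ∃ j, 0 < A s j := by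
  obtain ⟨j, -, hj⟩ := exists_ne_zero_of_sum_ne_zero h
  exact ⟨j, Nat.pos_of_ne_zero hj⟩

lemma exists_pos_of_co_ne_zero (h : co A c ≠ 0) : ∃ i, 0 < A i c := by
  obtain ⟨i, -, hi⟩ := exists_ne_zero_of_sum_ne_zero h
  exact ⟨i, Nat.pos_of_ne_zero hi⟩

lemma co_ne_zero_of_pos (h : 0 < A s c) : co A c ≠ 0 :=
  (sum_pos' (fun _ _ => Nat.zero_le _) ⟨s, mem_univ s, h⟩).ne'

end RowColumnSums

/-- `B` arises from `A` by moving one unit from row `s` to row `t` inside some column. The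
equation avoids the truncated subtraction in `B = A - E_{s,c} + E_{t,c}`. -/
def IsMove (s t : Fin n) (A B : Mat n r) : Prop :=
  ∃ c, B.1 + Matrix.single s c 1 = A.1 + Matrix.single t c 1

section IsMove

variable {s t c : Fin n} {A B : Mat n r}

lemma isMove_comm : IsMove s t A B ↔ IsMove t s B A :=
  exists_congr fun _ => eq_comm

lemma move_add_single (h : 0 < A.1 s c) :
    (move A s t c h).1 + Matrix.single s c 1 = A.1 + Matrix.single t c 1 := by
  ext i j
  have := single_le h i j
  simp only [move, Matrix.add_apply, Matrix.sub_apply]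
  omega

lemma isMove_move (h : 0 < A.1 s c) : IsMove s t A (move A s t c h) :=
  ⟨c, move_add_single h⟩

lemma exists_isMove (h : ro A.1 s ≠ 0) (t : Fin n) : ∃ B, IsMove s t A B := by
  obtain ⟨c, hc⟩ := exists_pos_of_ro_ne_zero h
  exact ⟨_, isMove_move hc⟩

namespace IsMove

lemma exists_eq_move (hst : s ≠ t) (h : IsMove s t A B) :
    ∃ c, ∃ hc : 0 < A.1 s c, B = move A s t c hc := by
  obtain ⟨c, hc⟩ := h
  have hpos : 0 < A.1 s c := by
    have := congrFun₂ hc s c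
    simp only [Matrix.add_apply, Matrix.single_apply, hst.symm, and_self, if_true, false_and,
      if_false] at this
    omega
  exact ⟨c, hpos, Subtype.ext (add_right_cancel (hc.trans (move_add_single hpos).symm))⟩

lemma dotProduct_ro_add (f : Fin n → ℕ) (h : IsMove s t A B) :
    f ⬝ᵥ ro B.1 + f s = f ⬝ᵥ ro A.1 + f t := by
  obtain ⟨c, hc⟩ := h
  simpa only [ro_add, ro_single, dotProduct_add, dotProduct_single, mul_one] using
    congrArg (fun X => f ⬝ᵥ ro X) hc

lemma co_eq (h : IsMove s t A B) : co B.1 = co A.1 := by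
  obtain ⟨c, hc⟩ := h
  simpa only [co_add, co_single, add_left_inj] using congrArg co hc

end IsMove

end IsMove

section ColumnBlockDiagonal

variable {A : Matrix (Fin n) (Fin n) ℕ}

lemma isColumnBlockDiagonal_iff : IsColumnBlockDiagonal A ↔
    ∀ i s j t, 0 < A i j → 0 < A s t → j < t → i < s :=
  ⟨fun hA i s j t hij hst hjt => not_le.1 fun hsi => hst.ne' (hA i j hij s t hsi hjt),
    fun hA i j hij s t hsi hjt =>
      Nat.eq_zero_of_not_pos fun hst => (hA i s j t hij hst hjt).not_ge hsi⟩

namespace IsColumnBlockDiagonal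

lemma row_lt_of_col_lt (hA : IsColumnBlockDiagonal A) {i s j t : Fin n} (hij : 0 < A i j)
    (hst : 0 < A s t) (hjt : j < t) : i < s :=
  isColumnBlockDiagonal_iff.1 hA i s j t hij hst hjt

lemma col_le_of_row_le (hA : IsColumnBlockDiagonal A) {i s j t : Fin n} (hij : 0 < A i j)
    (hst : 0 < A s t) (his : i ≤ s) : j ≤ t :=
  not_lt.1 fun htj => (hA.row_lt_of_col_lt hst hij htj).not_ge his

lemma eq_zero_of_ne (hA : IsColumnBlockDiagonal A) {i j t : Fin n} (hij : 0 < A i j)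
    (hjt : j ≠ t) : A i t = 0 :=
  Nat.eq_zero_of_not_pos fun hit =>
    hjt ((hA.col_le_of_row_le hij hit le_rfl).antisymm (hA.col_le_of_row_le hit hij le_rfl))

lemma move_up {A : Mat n r} (hA : IsColumnBlockDiagonal A.1) {s t c : Fin n} (hts : t ⋖ s)
    (hsc : 0 < A.1 s c) (ht : ∀ j, j ≠ c → A.1 t j = 0) :
    IsColumnBlockDiagonal (move A s t c hsc).1 := by
  have hsupport : ∀ i j, 0 < (move A s t c hsc).1 i j → 0 < A.1 i j ∨ i = t ∧ j = c := by
    intro i j hij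
    by_contra! h
    have hmove := congrFun₂ (move_add_single (t := t) hsc) i j
    have hsingle : Matrix.single t c 1 i j = 0 :=
      Matrix.single_apply_of_ne _ _ _ _ _ fun h' => h.2 h'.1.symm h'.2.symm
    simp only [Matrix.add_apply, hsingle] at hmove
    omega
  have hrow : ∀ i j, 0 < A.1 i j → j ≠ c → i ≠ t := by
    rintro i j hij hj rfl
    exact hij.ne' (ht j hj)
  refine isColumnBlockDiagonal_iff.2 fun i i' j j' hmove hmove' hlt => ?_
  rcases hsupport i j hmove with hij | ⟨rfl, rfl⟩ <;>
    rcases hsupport i' j' hmove' with hij' | ⟨rfl, rfl⟩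
  · exact hA.row_lt_of_col_lt hij hij' hlt
  · exact (hts.le_of_lt (hA.row_lt_of_col_lt hij hsc hlt)).lt_of_ne (hrow i j hij hlt.ne)
  · exact hts.lt.trans (hA.row_lt_of_col_lt hsc hij' hlt)
  · exact absurd hlt (lt_irrefl _)

end IsColumnBlockDiagonal

lemma diagMat_mem_CB (l : WComp n r) : diagMat l ∈ CB l := by
  refine ⟨fun i j hij s t hsi hjt => ?_, co_diagonal l.1⟩
  obtain rfl : i = j := by
    by_contra hne
    exact hij.ne' (Matrix.diagonal_apply_ne _ hne)
  exact Matrix.diagonal_apply_ne _ (hsi.trans_lt hjt).ne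

lemma eq_diagMat_of_isDiag {l : WComp n r} {A : Mat n r} (hA : A.1.IsDiag) (hco : co A.1 = l.1) :
    A = diagMat l := by
  have hdiagonal : Matrix.diagonal A.1.diag = A.1 := hA.diagonal_diag
  have hdiag : A.1.diag = l.1 := by rw [← co_diagonal A.1.diag, hdiagonal, hco]
  exact Subtype.ext (hdiagonal.symm.trans (congrArg Matrix.diagonal hdiag))

lemma colPart_embedding (A : Matrix (Fin n) (Fin n) ℕ) (α : Composition n) (v : Fin α.length)
    (i : Fin n) (u : Fin (α.blocksFun v)) :
    colPart A α v i (α.embedding v u) = A i (α.embedding v u) := by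
  have := α.sizeUpTo_succ' v
  refine if_pos ?_
  rw [Composition.coe_embedding]
  omega

lemma IsColumnBlockDiagonal.not_isOpenOnColumns (hA : IsColumnBlockDiagonal A)
    {α : Composition n} {v : Fin α.length} {a b : Fin (α.blocksFun v)} (hab : a < b)
    (ha : co A (α.embedding v a) ≠ 0) (hb : co A (α.embedding v b) ≠ 0) :
    ¬ IsOpenOnColumns A α := by
  intro hopen
  obtain ⟨i, hi⟩ := exists_pos_of_co_ne_zero ha
  obtain ⟨s, hs⟩ := exists_pos_of_co_ne_zero hb
  have hlt := (α.embedding v).strictMono hab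
  have := hopen v i s _ _ (hA.row_lt_of_col_lt hi hs hlt) hlt
  simp only [colPart_embedding] at this
  exact this.elim hi.ne' hs.ne'

lemma CB_subset_BSet (l : WComp n r) : CB l ⊆ BSet l := by
  rintro A ⟨hblock, hco⟩
  refine ⟨hco, fun hunion => ?_⟩
  simp only [Set.mem_iUnion] at hunion
  obtain ⟨α, ⟨hmax, hne⟩, -, hopen⟩ := hunion
  obtain ⟨b, hb, hb1⟩ := Composition.ne_ones_iff.1 hne
  obtain ⟨v, rfl⟩ := List.mem_ofFn.1 (α.ofFn_blocksFun.symm ▸ hb)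
  rcases hmax v with hone | ⟨hfirst, hlast⟩
  · exact hb1.ne' hone.1
  · have hlen : α.blocksFun v - 1 + 1 = α.blocksFun v := by omega
    refine hblock.not_isOpenOnColumns (v := v) (a := ⟨0, by omega⟩)
      (b := ⟨α.blocksFun v - 1, by omega⟩) (Fin.mk_lt_mk.2 (by omega)) ?_ ?_ hopen
    · exact hco ▸ hfirst _ rfl
    · exact hco ▸ hlast _ hlen

end ColumnBlockDiagonal

section UpwardMoves

lemma row₁_covBy_row₂ (i : Fin (n - 1)) : row₁ i ⋖ row₂ i :=
  Fin.covBy_iff.2 (Nat.covBy_iff_add_one_eq.2 rfl)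

lemma exists_row₂_eq {s : Fin n} (hs : (s : ℕ) ≠ 0) : ∃ i, row₂ i = s :=
  ⟨⟨s - 1, by omega⟩, Fin.ext (Nat.succ_pred hs)⟩

lemma IsColumnBlockDiagonal.isDiag_of_rows_above {A : Matrix (Fin n) (Fin n) ℕ}
    (hA : IsColumnBlockDiagonal A) (hco : ∀ i j, i < j → co A i = 0 → co A j = 0)
    (habove : ∀ i p, 0 < A (row₂ i) p → ∃ j ≠ p, 0 < A (row₁ i) j) : A.IsDiag := by
  suffices hdiag : ∀ s j, 0 < A s j → s = j from
    fun s j hne => Nat.eq_zero_of_not_pos fun hsj => hne (hdiag s j hsj)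
  intro s
  induction s using WellFoundedLT.induction with
  | ind s ih =>
    intro j hsj
    have hle : s ≤ j := by
      by_cases hs : (s : ℕ) = 0
      · exact Fin.le_def.2 (hs ▸ Nat.zero_le _)
      · obtain ⟨i, rfl⟩ := exists_row₂_eq hs
        have hcov := row₁_covBy_row₂ i
        obtain ⟨p, hpj, hp⟩ := habove i j hsj
        obtain rfl : row₁ i = p := ih _ hcov.lt p hp
        exact hcov.ge_of_gt ((hA.col_le_of_row_le hp hsj hcov.le).lt_of_ne hpj)
    refine hle.eq_of_not_lt fun hlt => ?_
    obtain ⟨q, hq⟩ := exists_pos_of_co_ne_zero fun h0 => co_ne_zero_of_pos hsj (hco s j hlt h0)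
    have hqs : q < s := hA.row_lt_of_col_lt hq hsj hlt
    exact hqs.ne (ih q hqs s hq)

lemma exists_upward_isMove_mem_CB {l : WComp n r} (hl : IsBullet l) {A : Mat n r} (hA : A ∈ CB l)
    (hne : A ≠ diagMat l) : ∃ i, ∃ B ∈ CB l, IsMove (row₂ i) (row₁ i) A B := by
  obtain ⟨i, p, hp, hrow⟩ :
      ∃ i p, 0 < A.1 (row₂ i) p ∧ ∀ j, j ≠ p → A.1 (row₁ i) j = 0 := by
    by_contra! hstuck
    refine hne (eq_diagMat_of_isDiag (hA.1.isDiag_of_rows_above (hA.2 ▸ hl) fun i p hp => ?_) hA.2)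
    obtain ⟨j, hj, hpos⟩ := hstuck i p hp
    exact ⟨j, hj, Nat.pos_of_ne_zero hpos⟩
  have hmove := isMove_move (t := row₁ i) hp
  exact ⟨i, _, ⟨hA.1.move_up (row₁_covBy_row₂ i) hp hrow, hmove.co_eq.trans hA.2⟩, hmove⟩

end UpwardMoves

section QuotientModule

variable {l : WComp n r} {A B : Mat n r}

/-- The quotient map from the regular module onto `S_λ`, which passes through `P_λ`. -/
noncomputable def toS (l : WComp n r) : Schur n r →ₗ[Schur n r] S l := (N l).mkQ ∘ₗ (QSub l).mkQ

lemma smul_eBar (x : Schur n r) (A : Mat n r) : x • eBar l A = toS l (x * e A) := rfl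

lemma restrictScalars_ker_toS (l : WComp n r) :
    (LinearMap.ker (toS l)).restrictScalars ℂ = Submodule.span ℂ (e '' (CB l)ᶜ) := by
  let π : Schur n r →ₗ[ℂ] P l := (QSub l).mkQ.restrictScalars ℂ
  have hker : LinearMap.ker π = Submodule.span ℂ (e '' (BSet l)ᶜ) :=
    Submodule.ext fun x => Submodule.Quotient.mk_eq_zero (QSub l)
  have hN : (N l).restrictScalars ℂ = (Submodule.span ℂ (e '' (BSet l \ CB l))).map π := by
    rw [Submodule.map_span, Set.image_image]
    rfl
  calc (LinearMap.ker (toS l)).restrictScalars ℂ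
      = ((N l).restrictScalars ℂ).comap π :=
        Submodule.ext fun x => Submodule.Quotient.mk_eq_zero (N l)
    _ = Submodule.span ℂ (e '' (BSet l \ CB l)) ⊔ Submodule.span ℂ (e '' (BSet l)ᶜ) := by
        rw [hN, Submodule.comap_map_eq, hker]
    _ = Submodule.span ℂ (e '' (CB l)ᶜ) := by
        rw [← Submodule.span_union, ← Set.image_union, Set.union_comm, Set.compl_eq_univ_sdiff,
          Set.sdiff_union_sdiff_cancel (Set.subset_univ _) (CB_subset_BSet l),
          ← Set.compl_eq_univ_sdiff]

lemma eBar_eq_zero (hA : A ∉ CB l) : eBar l A = 0 :=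
  (restrictScalars_ker_toS l).ge (Submodule.subset_span ⟨A, hA, rfl⟩)

lemma linearIndepOn_eBar (l : WComp n r) : LinearIndepOn ℂ (eBar l) (CB l) := by
  have hker : LinearMap.ker ((toS l).restrictScalars ℂ) = Submodule.span ℂ (e '' (CB l)ᶜ) :=
    restrictScalars_ker_toS l
  have hbasis : LinearIndependent ℂ (e : Mat n r → Schur n r) := (basis n r).linearIndependent
  refine (hbasis.comp _ Subtype.val_injective).map (f := (toS l).restrictScalars ℂ) ?_
  rw [hker, Set.range_comp, Subtype.range_coe]
  exact hbasis.disjoint_span_image disjoint_compl_right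

lemma eBar_ne_zero (hA : A ∈ CB l) : eBar l A ≠ 0 :=
  (linearIndepOn_eBar l).ne_zero hA

lemma eBar_inj (hB : B ∈ CB l) : eBar l A = eBar l B ↔ A = B := by
  refine ⟨fun h => ?_, fun h => h ▸ rfl⟩
  have hA : A ∈ CB l := by
    by_contra hA
    exact eBar_ne_zero hB (h.symm.trans (eBar_eq_zero hA))
  exact (linearIndepOn_eBar l).injOn hA hB h

lemma zero_notMem_eBar_image (l : WComp n r) : 0 ∉ eBar l '' CB l := by
  rintro ⟨A, hA, h⟩
  exact eBar_ne_zero hA h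

end QuotientModule

/-- `x` acts on the classes `ē_A`, `A ∈ CB(λ)`, by moving one unit from row `s` to row `t`, the
result being `0` if row `s` is zero or the move leaves `CB(λ)` (then `ē_B = 0`). This is the common
description of `e_i` and `f_i`. -/
structure ActsByMove (l : WComp n r) (s t : Fin n) (x : Schur n r) : Prop where
  smul_eq_zero : ∀ A ∈ CB l, ro A.1 s = 0 → x • eBar l A = 0
  smul_eq_of_isMove : ∀ A ∈ CB l, ∀ B, IsMove s t A B → x • eBar l A = eBar l B

namespace ActsByMove

variable {l : WComp n r} {s t : Fin n} {x y : Schur n r} {A B : Mat n r}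

lemma smul_eBar_eq_iff (hx : ActsByMove l s t x) (hA : A ∈ CB l) (hB : B ∈ CB l) :
    x • eBar l A = eBar l B ↔ IsMove s t A B := by
  refine ⟨fun h => ?_, hx.smul_eq_of_isMove A hA B⟩
  have hrow : ro A.1 s ≠ 0 := fun h0 =>
    eBar_ne_zero hB (h.symm.trans (hx.smul_eq_zero A hA h0))
  obtain ⟨C, hC⟩ := exists_isMove hrow t
  rwa [← (eBar_inj hB).1 ((hx.smul_eq_of_isMove A hA C hC).symm.trans h)]

lemma mapsTo (hx : ActsByMove l s t x) :
    Set.MapsTo (x • ·) (eBar l '' CB l) (insert 0 (eBar l '' CB l)) := by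
  rintro _ ⟨A, hA, rfl⟩
  by_cases hrow : ro A.1 s = 0
  · exact Or.inl (hx.smul_eq_zero A hA hrow)
  obtain ⟨C, hC⟩ := exists_isMove hrow t
  have hAC : x • eBar l A = eBar l C := hx.smul_eq_of_isMove A hA C hC
  by_cases hCB : C ∈ CB l
  · exact Or.inr ⟨C, hCB, hAC.symm⟩
  · exact Or.inl (hAC.trans (eBar_eq_zero hCB))

lemma isPartialInversePair (hx : ActsByMove l s t x) (hy : ActsByMove l t s y) :
    IsPartialInversePair (eBar l '' CB l) x y where
  mapsTo_left := hx.mapsTo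
  mapsTo_right := hy.mapsTo
  smul_eq_iff := by
    rintro _ ⟨A, hA, rfl⟩ _ ⟨B, hB, rfl⟩
    rw [hx.smul_eBar_eq_iff hA hB, hy.smul_eBar_eq_iff hB hA, isMove_comm]

end ActsByMove

section Generators

variable {l : WComp n r} {A C : Mat n r}

lemma actsByMove_eGen (l : WComp n r) (i : Fin (n - 1)) :
    ActsByMove l (row₂ i) (row₁ i) (eGen i) where
  smul_eq_zero A _ hrow := by rw [smul_eBar, eGen_mul_e_zero i A hrow, map_zero]
  smul_eq_of_isMove A hA B hAB := by
    obtain ⟨p, hp, rfl⟩ := hAB.exists_eq_move (row₁_covBy_row₂ i).lt.ne'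
    rw [smul_eBar, eGen_mul_e_move i A p hp fun j hj => hA.1.eq_zero_of_ne hp hj.ne]
    rfl

lemma actsByMove_fGen (l : WComp n r) (i : Fin (n - 1)) :
    ActsByMove l (row₁ i) (row₂ i) (fGen i) where
  smul_eq_zero A _ hrow := by rw [smul_eBar, fGen_mul_e_zero i A hrow, map_zero]
  smul_eq_of_isMove A hA B hAB := by
    obtain ⟨p, hp, rfl⟩ := hAB.exists_eq_move (row₁_covBy_row₂ i).lt.ne
    rw [smul_eBar, fGen_mul_e_move i A p hp fun j hj => hA.1.eq_zero_of_ne hp hj.ne']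
    rfl

lemma isPartialInversePair_eGen_fGen_prod (l : WComp n r) (w : List (Fin (n - 1))) :
    IsPartialInversePair (eBar l '' CB l) ((w.map eGen).prod : Schur n r)
      ((w.reverse.map fGen).prod : Schur n r) :=
  .list_prod (zero_notMem_eBar_image l)
    (fun i => (actsByMove_eGen l i).isPartialInversePair (actsByMove_fGen l i)) w

lemma eGen_prod_smul_eBar_eq_iff (hA : A ∈ CB l) (hC : C ∈ CB l) (w : List (Fin (n - 1))) :
    ((w.map eGen).prod : Schur n r) • eBar l A = eBar l C ↔
      eBar l A = ((w.reverse.map fGen).prod : Schur n r) • eBar l C :=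
  ((isPartialInversePair_eGen_fGen_prod l w).smul_eq_iff _ ⟨A, hA, rfl⟩ _ ⟨C, hC, rfl⟩).trans
    eq_comm

lemma IsMove.sum_rows_eq {i : Fin (n - 1)} {B : Mat n r} (h : IsMove (row₂ i) (row₁ i) A B)
    (k : Fin (n - 1)) :
    ∑ s ≤ row₁ k, ro B.1 s = ∑ s ≤ row₁ k, ro A.1 s + if i = k then 1 else 0 := by
  have hsum : ∀ g : Fin n → ℕ,
      (fun s => if s ≤ row₁ k then 1 else 0) ⬝ᵥ g = ∑ s ≤ row₁ k, g s := fun g => by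
    simp [dotProduct, ← sum_filter, filter_ge_eq_Iic]
  have hmove := h.dotProduct_ro_add fun s => if s ≤ row₁ k then 1 else 0
  rw [hsum, hsum] at hmove
  simp only [row₁, row₂, Fin.le_def, Fin.ext_iff] at hmove ⊢
  grind

lemma sum_rows_eq_add_count (hA : A ∈ CB l) (k : Fin (n - 1)) {w : List (Fin (n - 1))}
    (hC : C ∈ CB l) (h : ((w.map eGen).prod : Schur n r) • eBar l A = eBar l C) :
    ∑ s ≤ row₁ k, ro C.1 s = ∑ s ≤ row₁ k, ro A.1 s + w.count k := by
  induction w generalizing C with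
  | nil =>
    rw [List.map_nil, List.prod_nil, one_smul, eBar_inj hC] at h
    rw [h, List.count_nil, add_zero]
  | cons i w ih =>
    rw [List.map_cons, List.prod_cons] at h
    obtain ⟨B, hB, hAB⟩ := smul_mem_of_mul_smul_mem (zero_notMem_eBar_image l)
      (isPartialInversePair_eGen_fGen_prod l w).mapsTo_left ⟨A, hA, rfl⟩ ⟨C, hC, h.symm⟩
    rw [mul_smul, ← hAB] at h
    have hBC : IsMove (row₂ i) (row₁ i) B C := ((actsByMove_eGen l i).smul_eBar_eq_iff hB hC).1 h
    rw [hBC.sum_rows_eq k, ih hB hAB.symm, List.count_cons, add_assoc]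
    simp only [beq_iff_eq]

lemma perm_of_eGen_prod_smul_eBar_eq (hA : A ∈ CB l) (hC : C ∈ CB l) {w w' : List (Fin (n - 1))}
    (hw : ((w.map eGen).prod : Schur n r) • eBar l A = eBar l C)
    (hw' : ((w'.map eGen).prod : Schur n r) • eBar l A = eBar l C) : w.Perm w' :=
  List.perm_iff_count.2 fun k => by
    have := sum_rows_eq_add_count hA k hC hw
    have := sum_rows_eq_add_count hA k hC hw'
    omega

lemma exists_eGen_prod_smul_eBar_eq_kBar (hl : IsBullet l) (hA : A ∈ CB l) :
    ∃ w : List (Fin (n - 1)), ((w.map eGen).prod : Schur n r) • eBar l A = kBar l := by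
  induction hweight : Fin.val ⬝ᵥ ro A.1 using Nat.strong_induction_on generalizing A with
  | _ m ih =>
    by_cases hdiag : A = diagMat l
    · exact ⟨[], by rw [List.map_nil, List.prod_nil, one_smul, hdiag, kBar]⟩
    · obtain ⟨i, B, hB, hAB⟩ := exists_upward_isMove_mem_CB hl hA hdiag
      have hlt : Fin.val ⬝ᵥ ro B.1 < m := by
        have := hAB.dotProduct_ro_add Fin.val
        have : (row₁ i : ℕ) < row₂ i := (row₁_covBy_row₂ i).lt
        omega
      obtain ⟨w, hw⟩ := ih _ hlt hB rfl
      refine ⟨w ++ [i], ?_⟩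
      rw [List.map_append, List.prod_append, List.map_singleton, List.prod_singleton, mul_smul,
        (actsByMove_eGen l i).smul_eq_of_isMove A hA B hAB, hw]

end Generators

end ZeroSchur

theorem mainTheorem12 (n r : ℕ) (l : ZeroSchur.WComp n r) (hl : ZeroSchur.IsBullet l)
    (A : ZeroSchur.Mat n r) (hA : A ∈ ZeroSchur.CB l) :
    (∃ w : List (Fin (n - 1)),
      ((w.map ZeroSchur.Schur.eGen).prod : ZeroSchur.Schur n r) • ZeroSchur.eBar l A =
        ZeroSchur.kBar l) ∧
    (∀ w : List (Fin (n - 1)),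
      ((w.map ZeroSchur.Schur.eGen).prod : ZeroSchur.Schur n r) • ZeroSchur.eBar l A =
          ZeroSchur.kBar l ↔
        ZeroSchur.eBar l A =
          ((w.reverse.map ZeroSchur.Schur.fGen).prod : ZeroSchur.Schur n r) •
            ZeroSchur.kBar l) ∧
    (∀ w w' : List (Fin (n - 1)),
      ZeroSchur.eBar l A =
        ((w.reverse.map ZeroSchur.Schur.fGen).prod : ZeroSchur.Schur n r) • ZeroSchur.kBar l →
      ZeroSchur.eBar l A =
        ((w'.reverse.map ZeroSchur.Schur.fGen).prod : ZeroSchur.Schur n r) • ZeroSchur.kBar l →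
      (w : Multiset (Fin (n - 1))) = (w' : Multiset (Fin (n - 1))) ∧ w.length = w'.length) := by
  have hk := ZeroSchur.diagMat_mem_CB l
  have hreverse := ZeroSchur.eGen_prod_smul_eBar_eq_iff hA hk
  refine ⟨ZeroSchur.exists_eGen_prod_smul_eBar_eq_kBar hl hA, hreverse, fun w w' hw hw' => ?_⟩
  have hperm : w.Perm w' :=
    ZeroSchur.perm_of_eGen_prod_smul_eBar_eq hA hk ((hreverse w).2 hw) ((hreverse w').2 hw')
  exact ⟨Multiset.coe_eq_coe.2 hperm, hperm.length_eq⟩
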